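/- Let $0<q<1$, $1<\alpha<2$, $m>0$, $0<T<\infty$. **Operators and Sobolev spaces.** Let $\mathcal L$ be a positive self-adjoint operator on a separable Hilbert space $H$ possessing an orthonormal basis $(\psi_k)_{k\in I}$ of eigenvectors, $\mathcal L\psi_k=\lambda_k\psi_k$, $\lambda_k\ge 0$, $I$ countable. An $\mathcal L$-distribution is a formal series $c=\sum_k c_k\psi_k$ (a vector $h\in H$ has $c_k=\langle h,\psi_k\rangle$), and $\mathcal L$ and $(I+\mathcal L)^{s}$ act on it by multiplying $c_k$ by $\lambda_k$ and $(1+\lambda_k)^{s}$. For $d\in\mathbb R$, $\mathcal H^d_{\mathcal L}$ is the space of those $c$ with $(I+\mathcal L)^{d/2}c\in H$, with norm $\|c\|_{\mathcal H^d_{\mathcal L}}=\|(I+\mathcal L)^{d/2}c\|_H=\big(\sum_k(1+\lambda_k)^d|c_k|^2\big)^{1/2}$; for $d\ge0$ it is a subspace of $H$. **Quantum calculus.** Let $(a;q)_\infty=\prod_{n\ge0}(1-aq^n)$, $(a;q)_\nu=(a;q)_\infty/(q^\nu a;q)_\infty$, $\Gamma_q(x)=\frac{(q;q)_\infty}{(q^x;q)_\infty}(1-q)^{1-x}$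 for $x>0$, $D_qu(t)=\frac{u(t)-u(qt)}{(1-q)t}$ for $t\neq 0$, $\int_0^t g(s)\,d_qs=(1-q)t\sum_{n\ge0}q^ng(tq^n)$ (absolutely convergent), and $${}^cD_q^\alpha u(t)=\frac1{\Gamma_q(2-\alpha)}\int_0^t t^{1-\alpha}(qs/t;q)_{1-\alpha}\,D_q^2u(s)\,d_qs .$$ For functions with values in $\mathcal H^d_{\mathcal L}$ the convergence is absolute convergence in $\mathcal H^d_{\mathcal L}$, and $D_qu(0)=\rho$ means that $\frac{u(xq^n)-u(0)}{xq^n}\to\rho$ in $\mathcal H^d_{\mathcal L}$ as $n\to\infty$, for every $x\in(0,T]$. **Mittag-Leffler functions.** Let $e_{\alpha,\beta}(z;q)=\sum_{k\ge0}\frac{z^k}{\Gamma_q(\alpha k+\beta)}$, and let its $q$-translate be $$\varepsilon^{y}e_{\alpha,\beta}(ct^\alpha;q)=\sum_{k\ge0}\frac{c^kt^{\alpha k}(y/t;q)_{\alpha k}}{\Gamma_q(\alpha k+\beta)} ;$$ these power series in $z$, respectively in $z=ct^\alpha$ (with $y/t$ fixed), converge for $|z|(1-q)^\alpha<1$, and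 outside this disc the symbols denote their real-analytic continuation to $-\infty<z<(1-q)^{-\alpha}$. **Function spaces.** For functions on $[0,T]$ with values in $\mathcal H^d_{\mathcal L}$, the spaces $L_q^\infty([0,T];\mathcal H^{d}_{\mathcal L})$, $W_q^\alpha([0,T];\mathcal H^d_{\mathcal L})$ and $C_q^1([0,T];\mathcal H^d_{\mathcal L})$ are defined by finiteness of $\sup_{0\le t\le T}\|u(t)\|$, of $\sup_{0\le t\le T}\|u(t)\|+\sup_{0\le t\le T}\|{}^cD_q^\alpha u(t)\|$ (where ${}^cD_q^\alpha u$ is required to exist on $(0,T]$, and its value at $t=0$ is the empty integral $0$), and of $\sup_{0<t\le T}\|u(t)\|+\sup_{0<t\le T}\|D_qu(t)\|$, respectively. **Theorem.** There is a constant $C$, depending only on $q,\alpha,m,T$, such that the following holds for all $H$, $\mathcal L$ as above and all $d\in\mathbb R$. Let $\varphi,\rho\in\mathcal H^{d+2}_{\mathcal L}$ and $f\in C_q^1([0,T];\mathcal H^d_{\mathcal L})$. Then the problem $${}^cD_q^\alpha u(t)+\mathcal Lu(t)+mu(t)=f(t)\quad(0<t\le T),\qquad u(0)=\varphi,\qquad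 D_qu(0)=\rho$$ has a unique generalised solution $u\in L_q^\infty([0,T];\mathcal H^{d+2}_{\mathcal L})\cap W_q^\alpha([0,T];\mathcal H^d_{\mathcal L})$. For $0\le t\le T$ it is given by $$u(t)=\sum_{k\in I}\Big[\varphi_k\,e_{\alpha,1}(-(\lambda_k+m)t^\alpha;q)+t\,\rho_k\,e_{\alpha,2}(-(\lambda_k+m)t^\alpha;q)+\int_0^t t^{\alpha-1}(qs/t;q)_{\alpha-1}\,\varepsilon^{q^\alpha s}e_{\alpha,\alpha}(-(\lambda_k+m)t^\alpha;q)\,f_k(s)\,d_qs\Big]\psi_k,$$ where $\varphi_k,\rho_k,f_k$ are the Fourier coefficients and the Jackson integrals converge absolutely, and for $0\le t\le T$ it satisfies $$\|{}^cD_q^\alpha u(t)\|^2_{\mathcal H^d_{\mathcal L}}+\|u(t)\|^2_{\mathcal H^{d+2}_{\mathcal L}}\le C\Big[\|\varphi\|^2_{\mathcal H^{d+2}_{\mathcal L}}+\|\rho\|^2_{\mathcal H^{d+2}_{\mathcal L}}+\|f\|^2_{C_q^1([0,T];\mathcal H^d_{\mathcal L})}\Big].$$ -/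

import Mathlib

open Filter Topology
open scoped ENNReal NNReal

noncomputable section

/-! ### Quantum calculus -/

/-- The infinite `q`-shifted factorial `(a; q)_∞ = ∏_{n ≥ 0} (1 - a q ^ n)`. -/
def qPochInf (a q : ℝ) : ℝ := ∏' n : ℕ, (1 - a * q ^ n)

/-- The `q`-shifted factorial `(a; q)_ν = (a; q)_∞ / (q ^ ν a; q)_∞` of real order `ν`. -/
def qPoch (a q ν : ℝ) : ℝ := qPochInf a q / qPochInf (q ^ ν * a) q

/-- The `q`-Gamma function `Γ_q(x) = (q; q)_∞ / (q ^ x; q)_∞ * (1 - q) ^ (1 - x)`, `x > 0`. -/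
def qGamma (q x : ℝ) : ℝ := qPochInf q q / qPochInf (q ^ x) q * (1 - q) ^ (1 - x)

/-- The `q`-derivative `D_q u (t) = (u t - u (q t)) / (t (1 - q))` at a point `t ≠ 0`. -/
def qDeriv {E : Type*} [AddCommGroup E] [Module ℝ E] (q : ℝ) (u : ℝ → E) (t : ℝ) : E :=
  (t * (1 - q))⁻¹ • (u t - u (q * t))

/-- The Jackson integral `∫_0^a g(s) d_q s = (1 - q) a ∑_n q ^ n g(a q ^ n)`. -/
def jacksonIntegral {E : Type*} [AddCommGroup E] [Module ℝ E] [TopologicalSpace E]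
    (q a : ℝ) (g : ℝ → E) : E :=
  ((1 - q) * a) • ∑' n : ℕ, q ^ n • g (a * q ^ n)

/-- Absolute convergence of the Jackson integral `∫_0^a g(s) d_q s`. -/
def JacksonIntegrable {E : Type*} [NormedAddCommGroup E] [NormedSpace ℝ E]
    (q a : ℝ) (g : ℝ → E) : Prop :=
  Summable fun n : ℕ => ‖q ^ n • g (a * q ^ n)‖

/-- The kernel `(t - q s)_q ^ (ν) = t ^ ν (q s / t; q)_ν`. -/
def qPowKernel (q ν t s : ℝ) : ℝ := t ^ ν * qPoch (q * s / t) q ν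

/-- The Riemann--Liouville `q`-fractional integral of order `α > 0` with base point `0`:
`(I_q^α g)(t) = Γ_q(α)⁻¹ ∫_0^t (t - q s)_q ^ (α - 1) g(s) d_q s`. -/
def rlIntegral {E : Type*} [AddCommGroup E] [Module ℝ E] [TopologicalSpace E]
    (q α : ℝ) (g : ℝ → E) (t : ℝ) : E :=
  (qGamma q α)⁻¹ • jacksonIntegral q t fun s => qPowKernel q (α - 1) t s • g s

/-- The Caputo fractional `q`-derivative of non-integer order `α > 0` with base point `0`:
`ᶜD_q^α u = I_q^{n - α} D_q^n u` with `n = ⌈α⌉`. -/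
def caputo {E : Type*} [AddCommGroup E] [Module ℝ E] [TopologicalSpace E]
    (q α : ℝ) (u : ℝ → E) (t : ℝ) : E :=
  rlIntegral q (⌈α⌉₊ - α) ((qDeriv q)^[⌈α⌉₊] u) t

/-! ### The `q`-Mittag-Leffler function -/

/-- `g` is the real-analytic continuation to `(-∞, R)` of the sum of the power series
`∑ a k z ^ k`, which is required to converge for `|z| < R`. -/
def IsPowerSeriesContinuation (a : ℕ → ℝ) (R : ℝ) (g : ℝ → ℝ) : Prop :=
  AnalyticOnNhd ℝ g (Set.Iio R) ∧ ∀ z : ℝ, |z| < R → HasSum (fun k => a k * z ^ k) (g z)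

open Classical in
/-- The value at `z < R` of the (unique) real-analytic continuation to `(-∞, R)` of the sum of
the power series `∑ a k z ^ k`; by convention `0` if there is no continuation. -/
def powerSeriesContinuation (a : ℕ → ℝ) (R z : ℝ) : ℝ :=
  if h : ∃ g, IsPowerSeriesContinuation a R g then h.choose z else 0

/-- The continuation is unique, so `powerSeriesContinuation` does not depend on any choice. -/
theorem powerSeriesContinuation_eq {a : ℕ → ℝ} {R z : ℝ} {g : ℝ → ℝ}
    (hg : IsPowerSeriesContinuation a R g) (hR : 0 < R) (hz : z < R) :
    powerSeriesContinuation a R z = g z := by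
  have h : ∃ g, IsPowerSeriesContinuation a R g := ⟨g, hg⟩
  have hc := h.choose_spec
  rw [powerSeriesContinuation, dif_pos h]
  refine hc.1.eqOn_of_preconnected_of_eventuallyEq hg.1 isPreconnected_Iio
    (z₀ := 0) hR ?_ hz
  filter_upwards [Metric.ball_mem_nhds (0 : ℝ) hR] with w hw
  have hw' : |w| < R := by simpa using hw
  exact (hc.2 w hw').unique (hg.2 w hw')

/-- The `q`-Mittag-Leffler function `e_{α,β}(z; q) = ∑_k z ^ k / Γ_q(α k + β)` for
`|z (1 - q) ^ α| < 1`, continued real-analytically to all `z < (1 - q) ^ (-α)`. -/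
def qMittagLeffler (q α β z : ℝ) : ℝ :=
  powerSeriesContinuation (fun k => (qGamma q (α * k + β))⁻¹) ((1 - q) ^ (-α)) z

/-- The `q`-translate by `y` of `t ↦ e_{α,β}(c t ^ α; q)`, i.e.
`∑_k c ^ k t ^ (α k) (y / t; q)_{α k} / Γ_q(α k + β)`, the sum of this power series in
`z = c t ^ α` being continued real-analytically to all `z < (1 - q) ^ (-α)`. -/
def qMittagLefflerTranslate (q α β y c t : ℝ) : ℝ :=
  powerSeriesContinuation (fun k => qPoch (y / t) q (α * k) * (qGamma q (α * k + β))⁻¹)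
    ((1 - q) ^ (-α)) (c * t ^ α)

/-! ### Positive operators with discrete spectrum and their Sobolev scale -/

/-- A positive self-adjoint operator on a Hilbert space `H`, together with an orthonormal basis
of eigenvectors `ψ_k` and the corresponding eigenvalues `λ_k ≥ 0`. -/
structure PositiveOperator (𝕜 H I : Type*) [RCLike 𝕜] [NormedAddCommGroup H]
    [InnerProductSpace 𝕜 H] [CompleteSpace H] where
  /-- the (in general unbounded) operator -/
  op : H →ₗ.[𝕜] H
  isSelfAdjoint : IsSelfAdjoint op
  /-- the eigenbasis -/
  basis : HilbertBasis I 𝕜 H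
  /-- the eigenvalues -/
  eigenvalue : I → ℝ
  eigenvalue_nonneg : ∀ k, 0 ≤ eigenvalue k
  basis_mem : ∀ k, basis k ∈ op.domain
  op_basis : ∀ k, op ⟨basis k, basis_mem k⟩ = (eigenvalue k : 𝕜) • basis k

namespace PositiveOperator

variable {𝕜 H I : Type*} [RCLike 𝕜] [NormedAddCommGroup H] [InnerProductSpace 𝕜 H]
  [CompleteSpace H] (L : PositiveOperator 𝕜 H I)

/-- The Fourier coefficients `⟨h, ψ_k⟩` of a vector. General `𝓛`-distributions are given by
their families of Fourier coefficients `c : I → 𝕜` (formal series `∑ c_k ψ_k`), and `H` is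
embedded among them by this map. -/
def coeff (h : H) (k : I) : 𝕜 := inner 𝕜 (L.basis k) h

/-- The operator on `𝓛`-distributions: `𝓛 (∑ c_k ψ_k) = ∑ λ_k c_k ψ_k`. -/
def act (c : I → 𝕜) (k : I) : 𝕜 := L.eigenvalue k • c k

/-- The operator `(I + 𝓛) ^ s` on `𝓛`-distributions. -/
def onePlusPow (s : ℝ) (c : I → 𝕜) (k : I) : 𝕜 := ((1 + L.eigenvalue k) ^ s) • c k

/-- The norm `(∑_k (1 + λ_k) ^ d |c_k| ^ 2) ^ (1 / 2)` of the Sobolev space `𝓗^d`, with value `∞`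
outside this space. Thus `c ∈ 𝓗^d` means `L.eNorm d c < ∞`. -/
def eNorm (d : ℝ) (c : I → 𝕜) : ℝ≥0∞ :=
  (∑' k, ENNReal.ofReal ((1 + L.eigenvalue k) ^ d) * ‖c k‖ₑ ^ 2) ^ (1 / 2 : ℝ)

/-- The norm of `C_q^n([0, T]; 𝓗^d)`. -/
def eNormC (q : ℝ) (n : ℕ) (d T : ℝ) (u : ℝ → I → 𝕜) : ℝ≥0∞ :=
  ∑ i ∈ Finset.range (n + 1), ⨆ t ∈ Set.Ioc 0 T, L.eNorm d ((qDeriv q)^[i] u t)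

/-- `u ∈ C_q^n([0, T]; 𝓗^d)`. -/
def MemC (q : ℝ) (n : ℕ) (d T : ℝ) (u : ℝ → I → 𝕜) : Prop :=
  (∀ t ∈ Set.Icc 0 T, L.eNorm d (u t) < ∞) ∧ L.eNormC q n d T u < ∞

/-- `u ∈ L_q^∞([0, T]; 𝓗^d)`. -/
def MemLinfty (d T : ℝ) (u : ℝ → I → 𝕜) : Prop :=
  ⨆ t ∈ Set.Icc 0 T, L.eNorm d (u t) < ∞

/-- The Caputo derivative `ᶜD_q^α u (t)` exists for `0 < t ≤ T`: the Jackson integral that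
defines it converges absolutely in `𝓗^d`. -/
def HasCaputo (q α d T : ℝ) (u : ℝ → I → 𝕜) : Prop :=
  ∀ t ∈ Set.Ioc 0 T, ∑' n : ℕ, L.eNorm d
    (q ^ n • qPowKernel q (⌈α⌉₊ - α - 1) t (t * q ^ n) • (qDeriv q)^[⌈α⌉₊] u (t * q ^ n)) < ∞

/-- `u ∈ W_q^α([0, T]; 𝓗^d)`. -/
def MemW (q α d T : ℝ) (u : ℝ → I → 𝕜) : Prop :=
  L.HasCaputo q α d T u ∧
    (⨆ t ∈ Set.Icc 0 T, L.eNorm d (u t)) + (⨆ t ∈ Set.Icc 0 T, L.eNorm d (caputo q α u t)) < ∞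

/-- `D_q u (0) = ρ`: for every `x ∈ (0, T]`, the quotients `(u (x q ^ n) - u 0) / (x q ^ n)` tend
to `ρ` in `𝓗^d` as `n → ∞`. -/
def HasQDerivAtZero (q d T : ℝ) (u : ℝ → I → 𝕜) (ρ : I → 𝕜) : Prop :=
  ∀ x ∈ Set.Ioc 0 T, Tendsto
    (fun n : ℕ => L.eNorm d ((x * q ^ n)⁻¹ • (u (x * q ^ n) - u 0) - ρ)) atTop (𝓝 0)

/-- `u` is a generalised solution, in `L_q^∞([0, T]; 𝓗^{d+2}) ∩ W_q^α([0, T]; 𝓗^d)`, of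
`ᶜD_q^α u + 𝓛 u + m u = f` on `(0, T]`, `u 0 = φ`, `D_q u (0) = ρ`. -/
structure IsGeneralisedSolution (q α m d T : ℝ) (φ ρ : I → 𝕜) (f u : ℝ → I → 𝕜) : Prop where
  memLinfty : L.MemLinfty (d + 2) T u
  memW : L.MemW q α d T u
  equation : ∀ t ∈ Set.Ioc 0 T, caputo q α u t + L.act (u t) + m • u t = f t
  initial : u 0 = φ
  initial_deriv : L.HasQDerivAtZero q d T u ρ

/-- The integrand
`s ↦ t ^ (α - 1) (q s / t; q)_{α - 1} ε^{q ^ α s} e_{α,α}(-(λ_k + m) t ^ α; q) f_k(s)`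
of the Duhamel term of the series solution. -/
def duhamelIntegrand (q α m : ℝ) (f : ℝ → I → 𝕜) (t : ℝ) (k : I) (s : ℝ) : 𝕜 :=
  (qPowKernel q (α - 1) t s *
    qMittagLefflerTranslate q α α (q ^ α * s) (-(L.eigenvalue k + m)) t) • f s k

/-- The `k`-th Fourier coefficient at time `t` of the series solution. -/
def seriesSolution (q α m : ℝ) (φ ρ : I → 𝕜) (f : ℝ → I → 𝕜) (t : ℝ) (k : I) : 𝕜 :=
  qMittagLeffler q α 1 (-(L.eigenvalue k + m) * t ^ α) • φ k
    + (t * qMittagLeffler q α 2 (-(L.eigenvalue k + m) * t ^ α)) • ρ k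
    + jacksonIntegral q t (L.duhamelIntegrand q α m f t k)

/-! Compatibility of the definitions on `𝓛`-distributions with the operator on `H`. -/

theorem coeff_op (x : L.op.domain) : L.coeff (L.op x) = L.act (L.coeff (x : H)) := by
  ext k
  have hs := L.isSelfAdjoint
  have h := LinearPMap.adjoint_isFormalAdjoint hs.dense_domain
  rw [LinearPMap.isSelfAdjoint_def.mp hs] at h
  have h1 := h ⟨L.basis k, L.basis_mem k⟩ x
  rw [L.op_basis, inner_smul_left] at h1
  simp only [coeff, act]
  rw [← h1, RCLike.real_smul_eq_coe_mul]
  simp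

theorem eNorm_zero_coeff (h : H) : L.eNorm 0 (L.coeff h) = ‖h‖ₑ := by
  have h1 : HasSum (fun k => ‖L.coeff h k‖ ^ 2) (‖h‖ ^ 2) := by
    have := L.basis.hasSum_inner_mul_inner h h
    rw [inner_self_eq_norm_sq_to_K] at this
    have h2 := RCLike.hasSum_re 𝕜 this
    convert h2 using 1
    · ext k
      simp only [coeff]
      rw [← inner_conj_symm h (L.basis k), RCLike.conj_mul]
      norm_cast
    · norm_cast
  have h3 : ∑' k, ENNReal.ofReal ((1 + L.eigenvalue k) ^ (0 : ℝ)) * ‖L.coeff h k‖ₑ ^ 2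
      = ‖h‖ₑ ^ 2 := by
    have := ENNReal.ofReal_tsum_of_nonneg (fun k => by positivity) h1.summable
    rw [h1.tsum_eq] at this
    simp only [Real.rpow_zero, ENNReal.ofReal_one, one_mul]
    rw [← ofReal_norm, ← ENNReal.ofReal_pow (norm_nonneg _), this]
    refine tsum_congr fun k => ?_
    rw [← ofReal_norm, ← ENNReal.ofReal_pow (norm_nonneg _)]
  rw [eNorm, h3, ← ENNReal.rpow_natCast, ← ENNReal.rpow_mul]
  norm_num

theorem eNorm_eq_onePlusPow (d : ℝ) (c : I → 𝕜) :
    L.eNorm d c = L.eNorm 0 (L.onePlusPow (d / 2) c) := by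
  rw [eNorm, eNorm]
  congr 1
  refine tsum_congr fun k => ?_
  have hk : 0 < 1 + L.eigenvalue k := by linarith [L.eigenvalue_nonneg k]
  rw [onePlusPow, enorm_smul, mul_pow, Real.rpow_zero, ENNReal.ofReal_one, one_mul,
    ← ofReal_norm ((1 + L.eigenvalue k) ^ (d / 2)), ← ENNReal.ofReal_pow (norm_nonneg _),
    Real.norm_of_nonneg (by positivity), ← Real.rpow_natCast, ← Real.rpow_mul hk.le]
  norm_num

/-- `c ∈ 𝓗^d` if and only if `(I + 𝓛) ^ (d / 2) c ∈ H`. -/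
theorem eNorm_lt_top_iff (d : ℝ) (c : I → 𝕜) :
    L.eNorm d c < ∞ ↔ ∃ h : H, L.coeff h = L.onePlusPow (d / 2) c := by
  rw [eNorm_eq_onePlusPow]
  constructor
  · intro h
    set b := L.onePlusPow (d / 2) c
    have h1 : ∑' k, ‖b k‖ₑ ^ 2 ≠ ∞ := by
      intro h2
      simp [eNorm, h2] at h
    have h2 : Memℓp b 2 := by
      rw [memℓp_gen_iff (by norm_num)]
      have h3 : Summable fun k => (‖b k‖ₑ ^ 2).toReal := ENNReal.summable_toReal h1
      simpa using h3
    refine ⟨L.basis.repr.symm ⟨b, h2⟩, ?_⟩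
    ext k
    rw [coeff, ← HilbertBasis.repr_apply_apply]
    simp
  · rintro ⟨h, hh⟩
    rw [← hh, eNorm_zero_coeff]
    exact enorm_lt_top

end PositiveOperator

end

/-!
On the lattice `t q ^ n` the Jackson integral is a sum, so the fractional integral `I_q^α` is
`((1 - q) t) ^ α` times a sum with the `q`-binomial weights `(q ^ α; q)_n / (q; q)_n`, and the
`q`-Vandermonde identity gives the semigroup law. For `μ = λ_k + m` the resolvent
`(1 + μ I_q^α)⁻¹ I_q^α` has as weights the continuation of
`∑_k w ^ k (q ^ α r ^ k; q)_n / (q; q)_n` with `r = q ^ α` and `w = -μ ((1 - q) t) ^ α`. The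
continuation applies the functional `X ^ n ↦ (1 - w r ^ n)⁻¹` to a polynomial; it has no pole at
`w ≤ 0`, and there the weights, and the weights times `w`, are bounded uniformly in `w` and `n`.

By the `q`-binomial theorem the Mittag-Leffler functions and the kernel of the Duhamel integral are
expressed by these weights, so with `v = φ_k + t ρ_k` and the resolvent `R` the `k`-th coefficient
of the series is `v + R (f_k - μ v)`. Inverting the Caputo derivative turns the problem into the
Volterra equation `u = v + I_q^α (f_k - μ u)`. The series solves it because `R = I_q^α - μ I_q^α R`,
and the solution is unique because `R` commutes with `I_q^α`. The bound on the weights times `w`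
bounds `μ R` uniformly in `k`, which is the estimate with its gain of two orders of regularity.
-/

noncomputable section

open Finset.HasAntidiagonal (antidiagonal mem_antidiagonal)

/-! ### Finite `q`-shifted factorials -/

/-- The finite `q`-shifted factorial `(a; q)_n = ∏_{i < n} (1 - a q ^ i)`. -/
def qPochFin {R : Type*} [CommRing R] (a q : R) (n : ℕ) : R :=
  ∏ i ∈ Finset.range n, (1 - a * q ^ i)

/-- The coefficients `(a; q)_n / (q; q)_n` of the `q`-binomial series. -/
def qBinomCoeff {K : Type*} [Field K] (a q : K) (n : ℕ) : K :=
  qPochFin a q n / qPochFin q q n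

section CommRing

variable {R : Type*} [CommRing R] (a q : R) (n : ℕ)

@[simp] theorem qPochFin_zero : qPochFin a q 0 = 1 := by simp [qPochFin]

theorem qPochFin_succ : qPochFin a q (n + 1) = qPochFin a q n * (1 - a * q ^ n) := by
  simp [qPochFin, Finset.prod_range_succ]

theorem qPochFin_succ' : qPochFin a q (n + 1) = (1 - a) * qPochFin (a * q) q n := by
  simp only [qPochFin, Finset.prod_range_succ', pow_zero, mul_one]
  rw [mul_comm]
  congr 1
  exact Finset.prod_congr rfl fun i _ => by ring

theorem qPochFin_one_left : qPochFin 1 q n = if n = 0 then 1 else 0 := by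
  cases n with
  | zero => simp
  | succ n => simp [qPochFin_succ']

theorem map_qPochFin {S : Type*} [CommRing S] (f : R →+* S) :
    f (qPochFin a q n) = qPochFin (f a) (f q) n := by
  simp [qPochFin, map_prod]

end CommRing

section Field

variable {K : Type*} [Field K] {q : K}

theorem qPochFin_self_ne_zero (hq : ∀ n : ℕ, q ^ (n + 1) ≠ 1) (n : ℕ) : qPochFin q q n ≠ 0 :=
  Finset.prod_ne_zero_iff.2 fun i _ => sub_ne_zero.2 (by simpa [pow_succ'] using (hq i).symm)

@[simp] theorem qBinomCoeff_zero (a q : K) : qBinomCoeff a q 0 = 1 := by simp [qBinomCoeff]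

theorem qBinomCoeff_succ_mul (hq : ∀ n : ℕ, q ^ (n + 1) ≠ 1) (a : K) (n : ℕ) :
    qBinomCoeff a q (n + 1) * (1 - q ^ (n + 1)) = qBinomCoeff a q n * (1 - a * q ^ n) := by
  have hn : 1 - q ^ (n + 1) ≠ 0 := sub_ne_zero.2 (hq n).symm
  have := qPochFin_self_ne_zero hq n
  simp only [qBinomCoeff, qPochFin_succ, ← pow_succ']
  field_simp

theorem qBinomCoeff_succ_sub (hq : ∀ n : ℕ, q ^ (n + 1) ≠ 1) (a : K) (n : ℕ) :
    qBinomCoeff (a * q) q (n + 1) - a * qBinomCoeff (a * q) q n = qBinomCoeff a q (n + 1) := by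
  have hn : 1 - q ^ (n + 1) ≠ 0 := sub_ne_zero.2 (hq n).symm
  have := qPochFin_self_ne_zero hq n
  rw [qBinomCoeff, qBinomCoeff, qBinomCoeff, qPochFin_succ' a, qPochFin_succ (a * q),
    qPochFin_succ q, ← pow_succ']
  field_simp
  ring

/-- Both sides satisfy the same first order recurrence in `n`: split
`1 - q ^ n = (1 - q ^ j) + (1 - q ^ i) q ^ j` for `i + j = n`. -/
theorem qVandermonde (hq : ∀ n : ℕ, q ^ (n + 1) ≠ 1) (A B : K) (n : ℕ) :
    ∑ p ∈ antidiagonal n, qBinomCoeff A q p.1 * B ^ p.1 * qBinomCoeff B q p.2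
      = qBinomCoeff (A * B) q n := by
  induction n with
  | zero => simp
  | succ n ih =>
    refine mul_right_cancel₀ (sub_ne_zero.2 (hq n).symm) ?_
    calc (∑ p ∈ antidiagonal (n + 1),
          qBinomCoeff A q p.1 * B ^ p.1 * qBinomCoeff B q p.2) * (1 - q ^ (n + 1))
        = (∑ p ∈ antidiagonal (n + 1),
            qBinomCoeff A q p.1 * B ^ p.1 * (qBinomCoeff B q p.2 * (1 - q ^ p.2)))
          + ∑ p ∈ antidiagonal (n + 1),
            (qBinomCoeff A q p.1 * (1 - q ^ p.1)) * B ^ p.1 * qBinomCoeff B q p.2 * q ^ p.2 := by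
          rw [Finset.sum_mul, ← Finset.sum_add_distrib]
          refine Finset.sum_congr rfl fun p hp => ?_
          rw [← mem_antidiagonal.1 hp, pow_add]
          ring
      _ = (∑ p ∈ antidiagonal n,
            qBinomCoeff A q p.1 * B ^ p.1 * qBinomCoeff B q p.2) * (1 - A * B * q ^ n) := by
          rw [Finset.Nat.sum_antidiagonal_succ', Finset.Nat.sum_antidiagonal_succ]
          simp only [pow_zero, sub_self, mul_zero, zero_mul, zero_add, qBinomCoeff_succ_mul hq]
          rw [← Finset.sum_add_distrib, Finset.sum_mul]
          refine Finset.sum_congr rfl fun p hp => ?_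
          rw [← mem_antidiagonal.1 hp, pow_add]
          ring
      _ = qBinomCoeff (A * B) q (n + 1) * (1 - q ^ (n + 1)) := by
          rw [ih, qBinomCoeff_succ_mul hq]

end Field

section Real

variable {q : ℝ}

theorem pow_succ_ne_one (hq0 : 0 < q) (hq1 : q < 1) (n : ℕ) : q ^ (n + 1) ≠ 1 :=
  (pow_lt_one₀ hq0.le hq1 n.succ_ne_zero).ne

theorem mul_pow_lt_one {a : ℝ} (hq0 : 0 < q) (hq1 : q < 1) (ha : a < 1) (n : ℕ) :
    a * q ^ n < 1 := by
  have h1 : q ^ n ≤ 1 := pow_le_one₀ hq0.le hq1.le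
  have h0 : 0 < q ^ n := by positivity
  nlinarith

theorem qPochFin_pos {a : ℝ} (hq0 : 0 < q) (hq1 : q < 1) (ha : a < 1) (n : ℕ) :
    0 < qPochFin a q n :=
  Finset.prod_pos fun i _ => sub_pos.2 (mul_pow_lt_one hq0 hq1 ha i)

theorem qPochFin_le_one {a : ℝ} (hq0 : 0 < q) (hq1 : q < 1) (ha0 : 0 ≤ a) (ha1 : a < 1) (n : ℕ) :
    qPochFin a q n ≤ 1 :=
  Finset.prod_le_one (fun i _ => (sub_pos.2 (mul_pow_lt_one hq0 hq1 ha1 i)).le)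
    fun i _ => sub_le_self 1 (by positivity)

theorem prod_one_add_mul_pow_le (hq0 : 0 ≤ q) (hq1 : q < 1) {a : ℝ} (ha : 0 ≤ a) (n : ℕ) :
    ∏ i ∈ Finset.range n, (1 + a * q ^ i) ≤ Real.exp (a / (1 - q)) := by
  calc ∏ i ∈ Finset.range n, (1 + a * q ^ i)
      ≤ ∏ i ∈ Finset.range n, Real.exp (a * q ^ i) := by
        refine Finset.prod_le_prod (fun i _ => by positivity) fun i _ => ?_
        linarith [Real.add_one_le_exp (a * q ^ i)]
    _ = Real.exp (a * ∑ i ∈ Finset.range n, q ^ i) := by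
        rw [← Real.exp_sum, Finset.mul_sum]
    _ ≤ Real.exp (a / (1 - q)) := by
        rw [Real.exp_le_exp, div_eq_mul_inv, ← tsum_geometric_of_lt_one hq0 hq1]
        gcongr
        exact (summable_geometric_of_lt_one hq0 hq1).sum_le_tsum _ fun i _ => by positivity

theorem abs_qPochFin_le (hq0 : 0 < q) (hq1 : q < 1) (a : ℝ) (n : ℕ) :
    |qPochFin a q n| ≤ Real.exp (|a| / (1 - q)) := by
  refine le_trans ?_ (prod_one_add_mul_pow_le hq0.le hq1 (abs_nonneg a) n)
  rw [qPochFin, Finset.abs_prod]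
  refine Finset.prod_le_prod (fun i _ => abs_nonneg _) fun i _ => (abs_sub _ _).trans_eq ?_
  rw [abs_one, abs_mul, abs_of_pos (pow_pos hq0 i)]

/-! ### Infinite `q`-shifted factorials -/

theorem summable_mul_pow (hq0 : 0 < q) (hq1 : q < 1) (a : ℝ) : Summable fun n : ℕ => a * q ^ n :=
  (summable_geometric_of_lt_one hq0.le hq1).mul_left a

theorem multipliable_one_sub_mul_pow (hq0 : 0 < q) (hq1 : q < 1) (a : ℝ) :
    Multipliable fun n : ℕ => 1 - a * q ^ n := by
  simpa [sub_eq_add_neg] using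
    Real.multipliable_one_add_of_summable (summable_mul_pow hq0 hq1 (-a))

theorem tendsto_qPochFin (hq0 : 0 < q) (hq1 : q < 1) (a : ℝ) :
    Tendsto (qPochFin a q) atTop (𝓝 (qPochInf a q)) :=
  (multipliable_one_sub_mul_pow hq0 hq1 a).hasProd.tendsto_prod_nat

theorem qPochInf_pos (hq0 : 0 < q) (hq1 : q < 1) {a : ℝ} (ha : a < 1) : 0 < qPochInf a q := by
  have nonneg : 0 ≤ qPochInf a q :=
    ge_of_tendsto' (tendsto_qPochFin hq0 hq1 a) fun n => (qPochFin_pos hq0 hq1 ha n).le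
  have ne_zero := tprod_one_add_ne_zero_of_summable (f := fun n : ℕ => -(a * q ^ n))
    (fun n => by simpa [← sub_eq_add_neg] using (sub_pos.2 (mul_pow_lt_one hq0 hq1 ha n)).ne')
    (summable_mul_pow hq0 hq1 a).neg.norm
  exact nonneg.lt_of_ne' (by simpa [qPochInf, sub_eq_add_neg] using ne_zero)

theorem qPochFin_mul_qPochInf (hq0 : 0 < q) (hq1 : q < 1) (a : ℝ) (n : ℕ) :
    qPochFin a q n * qPochInf (a * q ^ n) q = qPochInf a q := by
  have shift : ∀ i : ℕ, 1 - a * q ^ n * q ^ i = 1 - a * q ^ (i + n) := fun i => by ring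
  have shifted := (multipliable_one_sub_mul_pow hq0 hq1 (a * q ^ n)).congr shift
  rw [qPochInf, tprod_congr shift]
  exact Multipliable.prod_mul_tprod_nat_mul' (f := fun i => 1 - a * q ^ i) shifted

theorem qPochInf_le_qPochFin (hq0 : 0 < q) (hq1 : q < 1) {a : ℝ} (ha0 : 0 ≤ a) (ha1 : a < 1)
    (n : ℕ) : qPochInf a q ≤ qPochFin a q n := by
  rw [← qPochFin_mul_qPochInf hq0 hq1 a n]
  refine mul_le_of_le_one_right (qPochFin_pos hq0 hq1 ha1 n).le ?_
  exact le_of_tendsto' (tendsto_qPochFin hq0 hq1 _) fun k =>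
    qPochFin_le_one hq0 hq1 (by positivity) (mul_pow_lt_one hq0 hq1 ha1 n) k

/-! ### The `q`-binomial theorem -/

/-- A bound for all the coefficients `(a; q)_n / (q; q)_n`. -/
def qBinomBound (a q : ℝ) : ℝ := Real.exp (|a| / (1 - q)) / qPochInf q q

theorem qBinomBound_nonneg (hq0 : 0 < q) (hq1 : q < 1) (a : ℝ) : 0 ≤ qBinomBound a q :=
  div_nonneg (Real.exp_pos _).le (qPochInf_pos hq0 hq1 hq1).le

theorem abs_div_qPochFin_self_le (hq0 : 0 < q) (hq1 : q < 1) {x M : ℝ} (hx : |x| ≤ M) (n : ℕ) :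
    |x / qPochFin q q n| ≤ M / qPochInf q q := by
  rw [abs_div, abs_of_pos (qPochFin_pos hq0 hq1 hq1 n)]
  exact div_le_div₀ ((abs_nonneg x).trans hx) hx (qPochInf_pos hq0 hq1 hq1)
    (qPochInf_le_qPochFin hq0 hq1 hq0.le hq1 n)

theorem abs_qBinomCoeff_le (hq0 : 0 < q) (hq1 : q < 1) (a : ℝ) (n : ℕ) :
    |qBinomCoeff a q n| ≤ qBinomBound a q :=
  abs_div_qPochFin_self_le hq0 hq1 (abs_qPochFin_le hq0 hq1 a n) n

theorem tendsto_qBinomCoeff (hq0 : 0 < q) (hq1 : q < 1) (a : ℝ) :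
    Tendsto (qBinomCoeff a q) atTop (𝓝 (qPochInf a q / qPochInf q q)) :=
  (tendsto_qPochFin hq0 hq1 a).div (tendsto_qPochFin hq0 hq1 q) (qPochInf_pos hq0 hq1 hq1).ne'

theorem summable_mul_geometric_of_bounded {x C : ℝ} (hx : |x| < 1) {c : ℕ → ℝ}
    (hc : ∀ n, |c n| ≤ C) : Summable fun n => x ^ n * c n := by
  refine .of_norm_bounded ((summable_geometric_of_lt_one (abs_nonneg x) hx).mul_right C) fun n => ?_
  rw [norm_mul, norm_pow, Real.norm_eq_abs, Real.norm_eq_abs]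
  gcongr
  exact hc n

/-- Let `n → ∞` in the `q`-Vandermonde identity with `A = a`, `B = x`. -/
theorem hasSum_qBinomCoeff (hq0 : 0 < q) (hq1 : q < 1) (a : ℝ) {x : ℝ} (hx : |x| < 1) :
    HasSum (fun n => x ^ n * qBinomCoeff a q n) (qPochInf (a * x) q / qPochInf x q) := by
  have hQ := (qPochInf_pos hq0 hq1 hq1).ne'
  have hX := (qPochInf_pos hq0 hq1 (abs_lt.1 hx).2).ne'
  have hs := summable_mul_geometric_of_bounded hx (abs_qBinomCoeff_le hq0 hq1 a)
  set F : ℕ → ℕ → ℝ := fun n i =>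
    if i ≤ n then x ^ i * qBinomCoeff a q i * qBinomCoeff x q (n - i) else 0
  have sum_F : ∀ n, ∑' i, F n i = qBinomCoeff (a * x) q n := fun n => by
    rw [← qVandermonde (pow_succ_ne_one hq0 hq1), Finset.Nat.sum_antidiagonal_eq_sum_range_succ
      fun i j => qBinomCoeff a q i * x ^ i * qBinomCoeff x q j,
      tsum_eq_sum (s := Finset.range (n + 1))
        fun i hi => if_neg fun h => hi (Finset.mem_range_succ_iff.2 h)]
    refine Finset.sum_congr rfl fun i hi => ?_
    simp only [if_pos (Finset.mem_range_succ_iff.1 hi)]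
    ring
  have lim_F : ∀ i, Tendsto (F · i) atTop
      (𝓝 (x ^ i * qBinomCoeff a q i * (qPochInf x q / qPochInf q q))) := fun i => by
    have h := ((tendsto_qBinomCoeff hq0 hq1 x).comp (tendsto_sub_atTop_nat i)).const_mul
      (x ^ i * qBinomCoeff a q i)
    refine h.congr' ?_
    filter_upwards [eventually_ge_atTop i] with n hn
    simp only [F, if_pos hn, Function.comp_apply]
  have bound_F : ∀ n i, ‖F n i‖ ≤ ‖x ^ i * qBinomCoeff a q i‖ * qBinomBound x q := fun n i => by
    have hB := qBinomBound_nonneg hq0 hq1 x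
    by_cases h : i ≤ n
    · simp only [F, if_pos h, norm_mul _ (qBinomCoeff x q _)]
      gcongr
      exact abs_qBinomCoeff_le hq0 hq1 x _
    · simp only [F, if_neg h, norm_zero]
      positivity
  have tannery := tendsto_tsum_of_dominated_convergence (hs.norm.mul_right (qBinomBound x q)) lim_F
    (Eventually.of_forall bound_F)
  simp only [sum_F, tsum_mul_right] at tannery
  have value := tendsto_nhds_unique tannery (tendsto_qBinomCoeff hq0 hq1 (a * x))
  convert hs.hasSum using 1
  field_simp at value ⊢
  exact value.symm

end Real

/-! ### The geometric functional -/

section Resolvent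

open Polynomial

/-- The linear functional `X ^ n ↦ (1 - w r ^ n)⁻¹` on polynomials. For `|w| < 1` it maps `P` to
`∑ w ^ k P(r ^ k)`, and it continues this sum to all `w` outside the poles. -/
def geomFunctional {F : Type*} [Field F] (r w : F) : F[X] →ₗ[F] F :=
  Polynomial.lsum fun n => (1 - w * r ^ n)⁻¹ • LinearMap.id

/-- The polynomial `(a X; q)_n`. -/
def qPochPoly {R : Type*} [CommRing R] (a q : R) (n : ℕ) : R[X] := qPochFin (C a * X) (C q) n

/-- The continuation in `w` of the series `∑_k w ^ k (a r ^ k; q)_n / (q; q)_n`. These are the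
coefficients of the resolvent of the fractional `q`-integral. -/
def resolventCoeff {F : Type*} [Field F] (q r a w : F) (n : ℕ) : F :=
  geomFunctional r w (qPochPoly a q n) / qPochFin q q n

section CommRing

variable {R : Type*} [CommRing R] (r a q : R) (n : ℕ)

theorem qPochPoly_eval (x : R) : (qPochPoly a q n).eval x = qPochFin (a * x) q n := by
  simp [qPochPoly, qPochFin, eval_prod]

theorem qPochPoly_comp : (qPochPoly a q n).comp (C r * X) = qPochPoly (a * r) q n := by
  simp [qPochPoly, qPochFin, prod_comp, mul_assoc]

theorem qPochPoly_map {S : Type*} [CommRing S] (f : R →+* S) :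
    (qPochPoly a q n).map f = qPochPoly (f a) (f q) n := by
  simp [qPochPoly, qPochFin, Polynomial.map_prod]

end CommRing

section Field

variable {F : Type*} [Field F] (r w a q : F)

theorem geomFunctional_monomial (n : ℕ) (c : F) :
    geomFunctional r w (monomial n c) = c * (1 - w * r ^ n)⁻¹ := by
  simp [geomFunctional, Polynomial.lsum_apply, Polynomial.sum_monomial_index, mul_comm]

theorem geomFunctional_X_pow_mul (i : ℕ) (P : F[X]) :
    geomFunctional r w (X ^ i * P) = geomFunctional r (w * r ^ i) P := by
  induction P using Polynomial.induction_on' with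
  | add P Q hP hQ => rw [mul_add, map_add, map_add, hP, hQ]
  | monomial n c =>
    rw [X_pow_mul_monomial, geomFunctional_monomial, geomFunctional_monomial]
    congr 3
    ring

theorem mul_geomFunctional_comp (hw : ∀ n : ℕ, 1 - w * r ^ n ≠ 0) (P : F[X]) :
    w * geomFunctional r w (P.comp (C r * X)) = geomFunctional r w P - P.eval 1 := by
  induction P using Polynomial.induction_on' with
  | add P Q hP hQ => rw [add_comp, map_add, map_add, mul_add, hP, hQ, eval_add]; ring
  | monomial n c =>
    have dilate : (monomial n c).comp (C r * X) = monomial n (c * r ^ n) := by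
      rw [monomial_comp, mul_pow, ← C_pow, ← mul_assoc, ← C_mul, C_mul_X_pow_eq_monomial]
    rw [dilate, geomFunctional_monomial, geomFunctional_monomial, eval_monomial]
    have := hw n
    field_simp
    ring

theorem map_geomFunctional {K : Type*} [Field K] (f : F →+* K) (P : F[X]) :
    f (geomFunctional r w P) = geomFunctional (f r) (f w) (P.map f) := by
  induction P using Polynomial.induction_on' with
  | add P Q hP hQ => rw [map_add, map_add, hP, hQ, Polynomial.map_add, map_add]
  | monomial n c => simp [geomFunctional_monomial]

theorem geomFunctional_qPochPoly_zero : geomFunctional r w (qPochPoly a q 0) = (1 - w)⁻¹ := by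
  simpa [qPochPoly] using geomFunctional_monomial r w 0 1

theorem geomFunctional_qPochPoly_succ (n : ℕ) :
    geomFunctional r w (qPochPoly a q (n + 1)) = geomFunctional r w (qPochPoly a q n)
      - a * q ^ n * geomFunctional r (w * r) (qPochPoly a q n) := by
  have h : qPochPoly a q (n + 1)
      = qPochPoly a q n - (a * q ^ n) • (X ^ 1 * qPochPoly a q n) := by
    rw [qPochPoly, qPochFin_succ, ← qPochPoly, smul_eq_C_mul, C_mul, C_pow]
    ring
  rw [h, map_sub, map_smul, geomFunctional_X_pow_mul, smul_eq_mul, pow_one]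

theorem map_resolventCoeff {K : Type*} [Field K] (f : F →+* K) (n : ℕ) :
    f (resolventCoeff q r a w n) = resolventCoeff (f q) (f r) (f a) (f w) n := by
  rw [resolventCoeff, map_div₀, map_geomFunctional, qPochPoly_map, map_qPochFin, resolventCoeff]

theorem mul_resolventCoeff (hw : ∀ n : ℕ, 1 - w * r ^ n ≠ 0) (n : ℕ) :
    w * resolventCoeff q r (a * r) w n = resolventCoeff q r a w n - qBinomCoeff a q n := by
  rw [resolventCoeff, ← mul_div_assoc, ← qPochPoly_comp, mul_geomFunctional_comp r w hw,
    qPochPoly_eval, mul_one, sub_div, resolventCoeff, qBinomCoeff]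

theorem qVandermonde_resolventCoeff [Infinite F] {q : F} (hq : ∀ n : ℕ, q ^ (n + 1) ≠ 1)
    (A B : F) (n : ℕ) :
    ∑ p ∈ antidiagonal n, qBinomCoeff A q p.1 * B ^ p.1 * resolventCoeff q r B (w * r ^ p.1) p.2
      = resolventCoeff q r (A * B) w n := by
  have polynomial_identity : ∑ p ∈ antidiagonal n,
      (qBinomCoeff A q p.1 * B ^ p.1 / qPochFin q q p.2) • (X ^ p.1 * qPochPoly B q p.2)
      = (qPochFin q q n)⁻¹ • qPochPoly (A * B) q n := by
    refine Polynomial.funext fun x => ?_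
    rw [eval_finsetSum, eval_smul, qPochPoly_eval, smul_eq_mul, mul_assoc A, inv_mul_eq_div,
      ← qBinomCoeff, ← qVandermonde hq]
    refine Finset.sum_congr rfl fun p _ => ?_
    rw [eval_smul, eval_mul, eval_pow, eval_X, qPochPoly_eval, smul_eq_mul, qBinomCoeff,
      qBinomCoeff]
    ring
  have h := congrArg (geomFunctional r w) polynomial_identity
  rw [map_sum, map_smul, smul_eq_mul, inv_mul_eq_div] at h
  rw [resolventCoeff, ← h]
  refine Finset.sum_congr rfl fun p _ => ?_
  rw [map_smul, geomFunctional_X_pow_mul, smul_eq_mul, resolventCoeff]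
  ring

theorem qVandermonde_resolventCoeff' [Infinite F] {q : F} (hq : ∀ n : ℕ, q ^ (n + 1) ≠ 1)
    (A B : F) (n : ℕ) :
    ∑ p ∈ antidiagonal n, resolventCoeff q r A w p.1 * B ^ p.1 * qBinomCoeff B q p.2
      = resolventCoeff q r (A * B) w n := by
  have polynomial_identity : ∑ p ∈ antidiagonal n,
      (B ^ p.1 * qBinomCoeff B q p.2 / qPochFin q q p.1) • qPochPoly A q p.1
      = (qPochFin q q n)⁻¹ • qPochPoly (A * B) q n := by
    refine Polynomial.funext fun x => ?_
    rw [eval_finsetSum, eval_smul, qPochPoly_eval, smul_eq_mul, mul_right_comm A, inv_mul_eq_div,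
      ← qBinomCoeff, ← qVandermonde hq]
    refine Finset.sum_congr rfl fun p _ => ?_
    rw [eval_smul, qPochPoly_eval, smul_eq_mul, qBinomCoeff, qBinomCoeff]
    ring
  have h := congrArg (geomFunctional r w) polynomial_identity
  rw [map_sum, map_smul, smul_eq_mul, inv_mul_eq_div] at h
  rw [resolventCoeff, ← h]
  refine Finset.sum_congr rfl fun p _ => ?_
  rw [map_smul, smul_eq_mul, resolventCoeff]
  ring

end Field

theorem norm_geomFunctional_qPochPoly_le {F : Type*} [NormedField F] (r a : F) {q w : F}
    (hq : ‖q‖ < 1) {M : ℝ} (hM : ∀ i : ℕ, ‖(1 - w * r ^ i)⁻¹‖ ≤ M) (n : ℕ) :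
    ‖geomFunctional r w (qPochPoly a q n)‖ ≤ M * Real.exp (‖a‖ / (1 - ‖q‖)) := by
  suffices h : ‖geomFunctional r w (qPochPoly a q n)‖
      ≤ M * ∏ i ∈ Finset.range n, (1 + ‖a‖ * ‖q‖ ^ i) by
    refine h.trans (mul_le_mul_of_nonneg_left ?_ ((norm_nonneg _).trans (hM 0)))
    exact prod_one_add_mul_pow_le (norm_nonneg q) hq (norm_nonneg a) n
  induction n generalizing w with
  | zero => simpa [geomFunctional_qPochPoly_zero] using hM 0
  | succ n ih =>
    have ih_dilated := ih (w := w * r) fun i => by simpa [pow_succ', mul_assoc] using hM (i + 1)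
    rw [geomFunctional_qPochPoly_succ, Finset.prod_range_succ]
    calc ‖geomFunctional r w (qPochPoly a q n)
          - a * q ^ n * geomFunctional r (w * r) (qPochPoly a q n)‖
        ≤ ‖geomFunctional r w (qPochPoly a q n)‖
          + ‖a * q ^ n * geomFunctional r (w * r) (qPochPoly a q n)‖ := norm_sub_le _ _
      _ ≤ M * ∏ i ∈ Finset.range n, (1 + ‖a‖ * ‖q‖ ^ i) + ‖a‖ * ‖q‖ ^ n *
          (M * ∏ i ∈ Finset.range n, (1 + ‖a‖ * ‖q‖ ^ i)) := by
        rw [norm_mul, norm_mul, norm_pow]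
        gcongr
        exact ih hM
      _ = M * ((∏ i ∈ Finset.range n, (1 + ‖a‖ * ‖q‖ ^ i)) * (1 + ‖a‖ * ‖q‖ ^ n)) := by ring

theorem analyticAt_geomFunctional {𝕜 : Type*} [NontriviallyNormedField 𝕜] {r w : 𝕜}
    (hw : ∀ n : ℕ, 1 - w * r ^ n ≠ 0) (P : 𝕜[X]) :
    AnalyticAt 𝕜 (fun w => geomFunctional r w P) w := by
  induction P using Polynomial.induction_on' with
  | add P Q hP hQ => simp only [map_add]; exact hP.fun_add hQ
  | monomial n c =>
    simp only [geomFunctional_monomial]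
    have := hw n
    fun_prop (disch := assumption)

theorem hasSum_geomFunctional {r w : ℝ} (hr0 : 0 ≤ r) (hr1 : r ≤ 1) (hw : |w| < 1) (P : ℝ[X]) :
    HasSum (fun k : ℕ => w ^ k * P.eval (r ^ k)) (geomFunctional r w P) := by
  induction P using Polynomial.induction_on' with
  | add P Q hP hQ => simpa only [eval_add, mul_add, map_add] using hP.add hQ
  | monomial n c =>
    rw [geomFunctional_monomial]
    have h : ‖w * r ^ n‖ < 1 := by
      rw [norm_mul, Real.norm_of_nonneg (by positivity : 0 ≤ r ^ n)]
      exact (mul_le_of_le_one_right (norm_nonneg _) (pow_le_one₀ hr0 hr1)).trans_lt hw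
    convert! (hasSum_geometric_of_norm_lt_one h).mul_left c using 2 with k
    rw [eval_monomial, mul_pow, ← pow_mul, ← pow_mul, mul_comm k n]
    ring

theorem one_sub_mul_pow_pos {r w : ℝ} (hr0 : 0 ≤ r) (hr1 : r ≤ 1) (hw : w < 1) (n : ℕ) :
    0 < 1 - w * r ^ n := by
  have h1 : r ^ n ≤ 1 := pow_le_one₀ hr0 hr1
  have h0 : 0 ≤ r ^ n := by positivity
  rcases le_total w 0 with h | h <;> nlinarith

/-! ### The resolvent series -/

theorem ofReal_resolventCoeff (q r a w : ℝ) (n : ℕ) :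
    ((resolventCoeff q r a w n : ℝ) : ℂ) = resolventCoeff (q : ℂ) r a w n :=
  map_resolventCoeff r w a q Complex.ofRealHom n

theorem norm_resolventCoeff_le {q : ℝ} (hq0 : 0 < q) (hq1 : q < 1) (r a : ℝ) {w : ℂ} {M : ℝ}
    (hM : ∀ i : ℕ, ‖(1 - w * (r : ℂ) ^ i)⁻¹‖ ≤ M) (n : ℕ) :
    ‖resolventCoeff (q : ℂ) r a w n‖ ≤ M * qBinomBound a q := by
  have hq : ‖(q : ℂ)‖ = q := by rw [Complex.norm_real, Real.norm_of_nonneg hq0.le]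
  have h := norm_geomFunctional_qPochPoly_le (r : ℂ) a (hq.trans_lt hq1) hM n
  have hn : ‖qPochFin (q : ℂ) q n‖ = qPochFin q q n := by
    rw [← Complex.ofRealHom_eq_coe, ← map_qPochFin, Complex.ofRealHom_eq_coe, Complex.norm_real,
      Real.norm_of_nonneg (qPochFin_pos hq0 hq1 hq1 n).le]
  rw [hq, Complex.norm_real, Real.norm_eq_abs] at h
  rw [resolventCoeff, norm_div, hn, qBinomBound, ← mul_div_assoc]
  exact div_le_div₀ ((norm_nonneg _).trans h) h (qPochInf_pos hq0 hq1 hq1)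
    (qPochInf_le_qPochFin hq0 hq1 hq0.le hq1 n)

theorem abs_resolventCoeff_le {q r w : ℝ} (hq0 : 0 < q) (hq1 : q < 1) (hr : 0 ≤ r) (hw : w ≤ 0)
    (a : ℝ) (n : ℕ) : |resolventCoeff q r a w n| ≤ qBinomBound a q := by
  have hM : ∀ i : ℕ, ‖(1 - (w : ℂ) * (r : ℂ) ^ i)⁻¹‖ ≤ 1 := fun i => by
    have : 1 ≤ 1 - w * r ^ i := by nlinarith [pow_nonneg hr i]
    rw [norm_inv]
    norm_cast
    exact inv_le_one_of_one_le₀ (this.trans (le_abs_self _))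
  have h := norm_resolventCoeff_le hq0 hq1 r a hM n
  rwa [one_mul, ← ofReal_resolventCoeff, Complex.norm_real, Real.norm_eq_abs] at h

/-- The series `∑_j x ^ j resolventCoeff q r a w j`, which continues the power series in `w` with
coefficients `∑_j x ^ j (a r ^ k; q)_j / (q; q)_j`. -/
def resolventSeries {F : Type*} [Field F] [TopologicalSpace F] (q r a x w : F) : F :=
  ∑' j : ℕ, x ^ j * resolventCoeff q r a w j

theorem ofReal_resolventSeries (q r a x w : ℝ) :
    ((resolventSeries q r a x w : ℝ) : ℂ) = resolventSeries (q : ℂ) r a x w := by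
  simp only [resolventSeries, Complex.ofReal_tsum, Complex.ofReal_mul, Complex.ofReal_pow,
    ofReal_resolventCoeff]

theorem one_sub_le_re_one_sub_mul_pow {r c : ℝ} (hr0 : 0 ≤ r) (hr1 : r ≤ 1) (hc : 0 ≤ c) {z : ℂ}
    (hz : z.re ≤ c) (n : ℕ) : 1 - c ≤ (1 - z * (r : ℂ) ^ n).re := by
  have h1 : r ^ n ≤ 1 := pow_le_one₀ hr0 hr1
  have h0 : 0 ≤ r ^ n := by positivity
  rw [← Complex.ofReal_pow, Complex.sub_re, Complex.re_mul_ofReal, Complex.one_re]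
  rcases le_total z.re 0 with _ | _ <;> nlinarith

theorem differentiableOn_resolventSeries {q r x c : ℝ} (hq0 : 0 < q) (hq1 : q < 1) (hr0 : 0 ≤ r)
    (hr1 : r ≤ 1) (hx : |x| < 1) (a : ℝ) (hc0 : 0 ≤ c) (hc1 : c < 1) :
    DifferentiableOn ℂ (resolventSeries (q : ℂ) r a x) {z | z.re < c} := by
  have hre : ∀ z : ℂ, z.re < c → ∀ n : ℕ, 1 - c ≤ (1 - z * (r : ℂ) ^ n).re := fun z hz =>
    one_sub_le_re_one_sub_mul_pow hr0 hr1 hc0 hz.le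
  refine Complex.differentiableOn_tsum_of_summable_norm
    ((summable_geometric_of_lt_one (abs_nonneg x) hx).mul_right ((1 - c)⁻¹ * qBinomBound a q))
    (fun j z hz => ?_) (isOpen_lt Complex.continuous_re continuous_const) fun j z hz => ?_
  · have no_pole : ∀ n : ℕ, 1 - z * (r : ℂ) ^ n ≠ 0 := fun n h => by
      have := hre z hz n
      rw [h, Complex.zero_re] at this
      linarith
    exact (((analyticAt_geomFunctional no_pole _).differentiableAt.div_const _).const_mul
      _).differentiableWithinAt
  · have inv_le : ∀ n : ℕ, ‖(1 - z * (r : ℂ) ^ n)⁻¹‖ ≤ (1 - c)⁻¹ := fun n => by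
      rw [norm_inv]
      exact inv_anti₀ (by linarith) ((hre z hz n).trans (Complex.re_le_norm _))
    rw [norm_mul, norm_pow, Complex.norm_real, Real.norm_eq_abs]
    gcongr
    exact norm_resolventCoeff_le hq0 hq1 r a inv_le j

theorem analyticAt_resolventSeries {q r x w : ℝ} (hq0 : 0 < q) (hq1 : q < 1) (hr0 : 0 ≤ r)
    (hr1 : r ≤ 1) (hx : |x| < 1) (a : ℝ) (hw : w < 1) :
    AnalyticAt ℝ (resolventSeries q r a x) w := by
  obtain ⟨c, hc, hc1⟩ := exists_between (max_lt hw one_pos)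
  obtain ⟨hwc, hc0⟩ := max_lt_iff.1 hc
  have hol := differentiableOn_resolventSeries hq0 hq1 hr0 hr1 hx a hc0.le hc1
  have h : AnalyticAt ℂ (resolventSeries (q : ℂ) r a x) (w : ℂ) := hol.analyticAt
    ((isOpen_lt Complex.continuous_re continuous_const).mem_nhds hwc)
  refine h.re_ofReal.congr (Eventually.of_forall fun s => ?_)
  simp only [← ofReal_resolventSeries, Complex.ofReal_re]

theorem hasSum_resolventSeries {q r x w : ℝ} (hq0 : 0 < q) (hq1 : q < 1) (hr0 : 0 ≤ r)
    (hr1 : r ≤ 1) (hx : |x| < 1) (a : ℝ) (hw : |w| < 1) :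
    HasSum (fun k => qPochInf (a * r ^ k * x) q / qPochInf x q * w ^ k)
      (resolventSeries q r a x w) := by
  set G : ℕ × ℕ → ℝ := fun p => w ^ p.2 * (x ^ p.1 * qBinomCoeff (a * r ^ p.2) q p.1)
  have summable_G : Summable G := by
    have h := (summable_geometric_of_lt_one (abs_nonneg w) hw).mul_of_nonneg
      (summable_geometric_of_lt_one (abs_nonneg x) hx) (fun _ => by positivity)
      fun _ => by positivity
    refine .of_norm_bounded (h.prod_symm.mul_right (qBinomBound a q)) fun p => ?_
    have coeff_le : |qBinomCoeff (a * r ^ p.2) q p.1| ≤ qBinomBound a q := by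
      refine abs_div_qPochFin_self_le hq0 hq1 ((abs_qPochFin_le hq0 hq1 _ _).trans ?_) _
      have : |a * r ^ p.2| ≤ |a| := by
        rw [abs_mul, abs_of_nonneg (pow_nonneg hr0 _)]
        exact mul_le_of_le_one_right (abs_nonneg a) (pow_le_one₀ hr0 hr1)
      have : 0 < 1 - q := sub_pos.2 hq1
      gcongr
    simp only [G, Prod.fst_swap, Prod.snd_swap, norm_mul, norm_pow, Real.norm_eq_abs, mul_assoc]
    gcongr
  have sum_over_k : ∀ j, HasSum (fun k => G (j, k)) (x ^ j * resolventCoeff q r a w j) := by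
    intro j
    have := ((hasSum_geomFunctional hr0 hr1 hw (qPochPoly a q j)).div_const
      (qPochFin q q j)).mul_left (x ^ j)
    convert! this using 2 with k
    simp only [G, qPochPoly_eval, qBinomCoeff]
    ring
  have sum_over_j : ∀ k, HasSum (fun j => G (j, k))
      (qPochInf (a * r ^ k * x) q / qPochInf x q * w ^ k) := fun k => by
    rw [mul_comm]
    exact (hasSum_qBinomCoeff hq0 hq1 (a * r ^ k) hx).mul_left (w ^ k)
  rw [resolventSeries, (summable_G.hasSum.prod_fiberwise sum_over_k).tsum_eq,
    ← (Equiv.prodComm ℕ ℕ).tsum_eq G]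
  exact summable_G.prod_symm.hasSum.prod_fiberwise sum_over_j

end Resolvent

/-! ### The `q`-Mittag-Leffler functions -/

namespace IsPowerSeriesContinuation

variable {b : ℕ → ℝ} {F : ℝ → ℝ}

theorem const_mul {R : ℝ} (h : IsPowerSeriesContinuation b R F) (K : ℝ) :
    IsPowerSeriesContinuation (fun k => K * b k) R fun z => K * F z :=
  ⟨fun z hz => analyticAt_const.mul (h.1 z hz), fun z hz => by
    simpa only [mul_assoc] using (h.2 z hz).mul_left K⟩

theorem rescale (h : IsPowerSeriesContinuation b 1 F) {c : ℝ} (hc : 0 < c) :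
    IsPowerSeriesContinuation (fun k => b k * c ^ k) c⁻¹ fun z => F (z * c) := by
  refine ⟨fun z hz => ?_, fun z hz => ?_⟩
  · refine (h.1 (z * c) ?_).fun_comp (f := fun z => z * c) (by fun_prop)
    simpa [hc.ne'] using mul_lt_mul_of_pos_right (Set.mem_Iio.1 hz) hc
  · have : |z * c| < 1 := by
      simpa [abs_mul, abs_of_pos hc, hc.ne'] using mul_lt_mul_of_pos_right hz hc
    simpa only [mul_pow, mul_assoc, mul_comm (c ^ _)] using h.2 _ this

end IsPowerSeriesContinuation

section

variable {q : ℝ}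

theorem isPowerSeriesContinuation_resolventSeries {r x : ℝ} (hq0 : 0 < q) (hq1 : q < 1)
    (hr0 : 0 ≤ r) (hr1 : r ≤ 1) (hx : |x| < 1) (a : ℝ) :
    IsPowerSeriesContinuation (fun k => qPochInf (a * r ^ k * x) q / qPochInf x q) 1
      (resolventSeries q r a x) :=
  ⟨fun _ => analyticAt_resolventSeries hq0 hq1 hr0 hr1 hx a,
    fun _ => hasSum_resolventSeries hq0 hq1 hr0 hr1 hx a⟩

theorem isPowerSeriesContinuation_resolventCoeff {r : ℝ} (hr0 : 0 ≤ r) (hr1 : r ≤ 1) (q a : ℝ)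
    (n : ℕ) :
    IsPowerSeriesContinuation (fun k => qBinomCoeff (a * r ^ k) q n) 1
      fun w => resolventCoeff q r a w n := by
  refine ⟨fun w hw => ?_, fun w hw => ?_⟩
  · have no_pole := fun i => (one_sub_mul_pow_pos hr0 hr1 hw i).ne'
    exact (analyticAt_geomFunctional no_pole _).div_const
  · have h := (hasSum_geomFunctional hr0 hr1 hw (qPochPoly a q n)).div_const (qPochFin q q n)
    refine h.congr_fun fun k => ?_
    simp only [qPochPoly_eval, qBinomCoeff]
    ring

theorem qGamma_pos (hq0 : 0 < q) (hq1 : q < 1) {x : ℝ} (hx : 0 < x) : 0 < qGamma q x :=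
  mul_pos (div_pos (qPochInf_pos hq0 hq1 hq1)
    (qPochInf_pos hq0 hq1 (Real.rpow_lt_one hq0.le hq1 hx)))
    (Real.rpow_pos_of_pos (sub_pos.2 hq1) _)

theorem qGamma_one (hq0 : 0 < q) (hq1 : q < 1) : qGamma q 1 = 1 := by
  simp [qGamma, (qPochInf_pos hq0 hq1 hq1).ne']

theorem qGamma_two (hq0 : 0 < q) (hq1 : q < 1) : qGamma q 2 = 1 := by
  have hsucc : qPochInf q q = (1 - q) * qPochInf (q ^ 2) q := by
    simpa [qPochFin_succ, qPochFin_zero, pow_two] using (qPochFin_mul_qPochInf hq0 hq1 q 1).symm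
  have hne := (qPochInf_pos hq0 hq1 (pow_lt_one₀ hq0.le hq1 two_ne_zero)).ne'
  have hq : 1 - q ≠ 0 := (sub_pos.2 hq1).ne'
  rw [qGamma, hsucc, Real.rpow_two, show (1 : ℝ) - 2 = -1 by norm_num, Real.rpow_neg_one]
  field_simp

theorem inv_qGamma_mul_natCast_add (hq0 : 0 < q) (hq1 : q < 1) (α : ℝ) {β : ℝ} (hβ : 0 < β)
    (k : ℕ) :
    (qGamma q (α * k + β))⁻¹
      = (qGamma q β)⁻¹ * (qPochInf (1 * (q ^ α) ^ k * q ^ β) q / qPochInf (q ^ β) q)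
        * ((1 - q) ^ α) ^ k := by
  have h1q : 0 < 1 - q := sub_pos.2 hq1
  have hne := (qPochInf_pos hq0 hq1 (Real.rpow_lt_one hq0.le hq1 hβ)).ne'
  have hpow : ((1 - q) ^ (1 - (α * k + β)))⁻¹ = ((1 - q) ^ (1 - β))⁻¹ * ((1 - q) ^ α) ^ k := by
    rw [← Real.rpow_neg h1q.le, ← Real.rpow_neg h1q.le, ← Real.rpow_mul_natCast h1q.le,
      ← Real.rpow_add h1q]
    ring_nf
  rw [qGamma, qGamma, Real.rpow_add hq0, Real.rpow_mul_natCast hq0.le, mul_inv, hpow, one_mul]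
  field_simp

/-- By the `q`-binomial theorem with `x = q ^ β`, the power series of `e_{α,β}` is that of a
resolvent series in the rescaled variable `z (1 - q) ^ α`. -/
theorem qMittagLeffler_eq (hq0 : 0 < q) (hq1 : q < 1) {α β z : ℝ} (hα : 0 ≤ α) (hβ : 0 < β)
    (hz : z < (1 - q) ^ (-α)) :
    qMittagLeffler q α β z
      = (qGamma q β)⁻¹ * resolventSeries q (q ^ α) 1 (q ^ β) (z * (1 - q) ^ α) := by
  have h1q : 0 < 1 - q := sub_pos.2 hq1
  have hx : |q ^ β| < 1 := by
    rw [abs_of_pos (by positivity)]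
    exact Real.rpow_lt_one hq0.le hq1 hβ
  have h := ((isPowerSeriesContinuation_resolventSeries hq0 hq1 (by positivity)
    (Real.rpow_le_one hq0.le hq1.le hα) hx 1).const_mul (qGamma q β)⁻¹).rescale
    (Real.rpow_pos_of_pos h1q α)
  simp only [← inv_qGamma_mul_natCast_add hq0 hq1 α hβ, ← Real.rpow_neg h1q.le] at h
  exact powerSeriesContinuation_eq h (by positivity) hz

theorem qPowKernel_lattice (hq0 : 0 < q) (hq1 : q < 1) {β t : ℝ} (hβ : 0 < β) (ht : 0 < t)
    (n : ℕ) :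
    qPowKernel q (β - 1) t (t * q ^ n)
      = qGamma q β * ((1 - q) * t) ^ (β - 1) * qBinomCoeff (q ^ β) q n := by
  have h1q : 0 < 1 - q := sub_pos.2 hq1
  have hβ1 : q ^ β < 1 := Real.rpow_lt_one hq0.le hq1 hβ
  have h1 := (qPochInf_pos hq0 hq1 (mul_pow_lt_one hq0 hq1 hβ1 n)).ne'
  have h2 := (qPochFin_pos hq0 hq1 hβ1 n).ne'
  have h3 := (qPochFin_pos hq0 hq1 hq1 n).ne'
  have hpow : (1 - q) ^ (1 - β) * (1 - q) ^ (β - 1) = 1 := by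
    rw [← Real.rpow_add h1q]
    simp
  rw [qPowKernel, qPoch, qGamma, qBinomCoeff, ← qPochFin_mul_qPochInf hq0 hq1 q n,
    ← qPochFin_mul_qPochInf hq0 hq1 (q ^ β) n, Real.mul_rpow h1q.le ht.le,
    show q * (t * q ^ n) / t = q * q ^ n by field_simp,
    show q ^ (β - 1) * (q * q ^ n) = q ^ β * q ^ n by
      rw [Real.rpow_sub hq0, Real.rpow_one]; field_simp]
  generalize qPochInf (q ^ β * q ^ n) q = X at h1 ⊢
  field_simp
  linear_combination (-qPochInf (q * q ^ n) q) * hpow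

theorem qPoch_mul_inv_qGamma (hq0 : 0 < q) (hq1 : q < 1) {α β : ℝ} (hα : 0 ≤ α) (hβ : 0 < β)
    (n k : ℕ) :
    qPoch (q ^ β * q ^ n) q (α * k) * (qGamma q (α * k + β))⁻¹
      = (qGamma q β * qBinomCoeff (q ^ β) q n)⁻¹ * qBinomCoeff (q ^ β * (q ^ α) ^ k) q n
        * ((1 - q) ^ α) ^ k := by
  have hβ1 : q ^ β < 1 := Real.rpow_lt_one hq0.le hq1 hβ
  have hk : q ^ β * (q ^ α) ^ k < 1 := mul_lt_one_of_nonneg_of_lt_one_left (by positivity) hβ1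
    (pow_le_one₀ (by positivity) (Real.rpow_le_one hq0.le hq1.le hα))
  have h1 := (qPochInf_pos hq0 hq1 (mul_pow_lt_one hq0 hq1 hk n)).ne'
  have h2 := (qPochInf_pos hq0 hq1 (mul_pow_lt_one hq0 hq1 hβ1 n)).ne'
  have h3 := (qPochFin_pos hq0 hq1 hβ1 n).ne'
  have h4 := (qPochFin_pos hq0 hq1 hq1 n).ne'
  rw [inv_qGamma_mul_natCast_add hq0 hq1 α hβ, qPoch, Real.rpow_mul_natCast hq0.le, one_mul,
    mul_comm ((q ^ α) ^ k) (q ^ β), ← qPochFin_mul_qPochInf hq0 hq1 (q ^ β) n,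
    ← qPochFin_mul_qPochInf hq0 hq1 (q ^ β * (q ^ α) ^ k) n, qBinomCoeff, qBinomCoeff,
    show (q ^ α) ^ k * (q ^ β * q ^ n) = q ^ β * (q ^ α) ^ k * q ^ n by ring]
  generalize qPochInf (q ^ β * (q ^ α) ^ k * q ^ n) q = X at h1 ⊢
  generalize qPochInf (q ^ β * q ^ n) q = Y at h2 ⊢
  field_simp

theorem qMittagLefflerTranslate_lattice (hq0 : 0 < q) (hq1 : q < 1) {α β c t : ℝ} (hα : 0 ≤ α)
    (hβ : 0 < β) (ht : 0 < t) (hc : c * t ^ α < (1 - q) ^ (-α)) (n : ℕ) :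
    qMittagLefflerTranslate q α β (q ^ β * (t * q ^ n)) c t
      = (qGamma q β * qBinomCoeff (q ^ β) q n)⁻¹ *
        resolventCoeff q (q ^ α) (q ^ β) (c * t ^ α * (1 - q) ^ α) n := by
  have h1q : 0 < 1 - q := sub_pos.2 hq1
  have h := ((isPowerSeriesContinuation_resolventCoeff (by positivity)
    (Real.rpow_le_one hq0.le hq1.le hα) q (q ^ β) n).const_mul
      (qGamma q β * qBinomCoeff (q ^ β) q n)⁻¹).rescale (Real.rpow_pos_of_pos h1q α)
  simp only [← qPoch_mul_inv_qGamma hq0 hq1 hα hβ, ← Real.rpow_neg h1q.le] at h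
  rw [qMittagLefflerTranslate, show q ^ β * (t * q ^ n) / t = q ^ β * q ^ n by field_simp]
  exact powerSeriesContinuation_eq h (by positivity) hc

theorem qPowKernel_mul_qMittagLefflerTranslate (hq0 : 0 < q) (hq1 : q < 1) {α β c t : ℝ}
    (hα : 0 ≤ α) (hβ : 0 < β) (ht : 0 < t) (hc : c * t ^ α < (1 - q) ^ (-α)) (n : ℕ) :
    qPowKernel q (β - 1) t (t * q ^ n) *
        qMittagLefflerTranslate q α β (q ^ β * (t * q ^ n)) c t
      = ((1 - q) * t) ^ (β - 1) *
        resolventCoeff q (q ^ α) (q ^ β) (c * t ^ α * (1 - q) ^ α) n := by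
  have h1 := (qGamma_pos hq0 hq1 hβ).ne'
  have h2 : qBinomCoeff (q ^ β) q n ≠ 0 := (div_pos
    (qPochFin_pos hq0 hq1 (Real.rpow_lt_one hq0.le hq1 hβ) n) (qPochFin_pos hq0 hq1 hq1 n)).ne'
  rw [qPowKernel_lattice hq0 hq1 hβ ht, qMittagLefflerTranslate_lattice hq0 hq1 hα hβ ht hc]
  field_simp

end

/-! ### Weighted Jackson sums -/

section JacksonSum

variable {E : Type*} [NormedAddCommGroup E] {q : ℝ}

theorem mem_Ioc_mul_pow (hq0 : 0 < q) (hq1 : q < 1) {t T : ℝ} (ht : t ∈ Set.Ioc 0 T) (n : ℕ) :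
    t * q ^ n ∈ Set.Ioc 0 T :=
  ⟨mul_pos ht.1 (pow_pos hq0 n),
    (mul_le_of_le_one_right ht.1.le (pow_le_one₀ hq0.le hq1.le)).trans ht.2⟩

theorem mul_pow_rpow (hq0 : 0 < q) {s : ℝ} (hs : 0 ≤ s) (a : ℝ) (i : ℕ) :
    (s * q ^ i) ^ a = s ^ a * (q ^ a) ^ i := by
  rw [Real.mul_rpow hs (by positivity), Real.rpow_pow_comm hq0.le]

theorem summable_antidiagonal_of_bounded (hq0 : 0 < q) (hq1 : q < 1) {x M : ℝ} (hx0 : 0 ≤ x)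
    (hx1 : x * q < 1) {g : ℕ → E} (hg : ∀ n, ‖g n‖ ≤ M) :
    Summable fun p : ℕ × ℕ => x ^ p.1 * (q ^ (p.1 + p.2) * ‖g (p.1 + p.2)‖) := by
  refine Summable.of_nonneg_of_le (fun p => by positivity) (fun p => ?_)
    (((summable_geometric_of_lt_one (by positivity) hx1).mul_of_nonneg
      (summable_geometric_of_lt_one hq0.le hq1) (fun _ => by positivity)
      (fun _ => by positivity)).mul_right M)
  rw [pow_add, mul_pow, ← mul_assoc, ← mul_assoc]
  exact mul_le_mul_of_nonneg_left (hg _) (by positivity)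

theorem summable_antidiagonal_of_summable {x : ℝ} (hx0 : 0 ≤ x) (hx1 : x < 1) {b : ℕ → ℝ}
    (hb0 : ∀ n, 0 ≤ b n) (hb : Summable b) :
    Summable fun p : ℕ × ℕ => x ^ p.1 * b (p.1 + p.2) := by
  have hi : ∀ i, Summable fun j => b (i + j) := fun i => hb.comp_injective (add_right_injective i)
  refine (summable_prod_of_nonneg fun p => mul_nonneg (by positivity) (hb0 _)).2
    ⟨fun i => (hi i).mul_left (x ^ i), ?_⟩
  refine Summable.of_nonneg_of_le (fun i => tsum_nonneg fun j => mul_nonneg (by positivity) (hb0 _))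
    (fun i => ?_) ((summable_geometric_of_lt_one hx0 hx1).mul_right (∑' n, b n))
  simp only [tsum_mul_left]
  exact mul_le_mul_of_nonneg_left ((hi i).tsum_le_tsum_of_inj _ (add_right_injective i)
    (fun n _ => hb0 n) (fun _ => le_rfl) hb) (by positivity)

variable [NormedSpace ℝ E]

theorem jacksonIntegrable_iff (hq0 : 0 < q) {t : ℝ} {g : ℝ → E} :
    JacksonIntegrable q t g ↔ Summable fun n : ℕ => q ^ n * ‖g (t * q ^ n)‖ := by
  simp only [JacksonIntegrable, norm_smul, Real.norm_of_nonneg (pow_nonneg hq0.le _)]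

theorem jacksonIntegrable_of_bounded (hq0 : 0 < q) (hq1 : q < 1) {t M : ℝ} {g : ℝ → E}
    (hg : ∀ n : ℕ, ‖g (t * q ^ n)‖ ≤ M) : JacksonIntegrable q t g := by
  refine (jacksonIntegrable_iff hq0).2 (Summable.of_nonneg_of_le (fun n => by positivity)
    (fun n => ?_) ((summable_geometric_of_lt_one hq0.le hq1).mul_right M))
  exact mul_le_mul_of_nonneg_left (hg n) (by positivity)

theorem JacksonIntegrable.mul_pow {t : ℝ} {g : ℝ → E} (hg : JacksonIntegrable q t g)
    (hq0 : 0 < q) (k : ℕ) : JacksonIntegrable q (t * q ^ k) g := by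
  rw [jacksonIntegrable_iff hq0] at hg ⊢
  refine (((summable_nat_add_iff k).2 hg).mul_left (q ^ k)⁻¹).congr fun n => ?_
  rw [pow_add, mul_comm (q ^ n) (q ^ k), mul_assoc t]
  field_simp

theorem JacksonIntegrable.bdd_smul {t K : ℝ} {g : ℝ → E} (hg : JacksonIntegrable q t g)
    {c : ℝ → ℝ} (hc : ∀ n : ℕ, |c (t * q ^ n)| ≤ K) : JacksonIntegrable q t fun s => c s • g s := by
  refine .of_nonneg_of_le (fun n => norm_nonneg _) (fun n => ?_) (hg.mul_left K)
  rw [smul_comm, norm_smul, Real.norm_eq_abs]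
  exact mul_le_mul_of_nonneg_right (hc n) (norm_nonneg _)

theorem JacksonIntegrable.sub_smul {t : ℝ} {g h : ℝ → E} (hg : JacksonIntegrable q t g)
    (hh : JacksonIntegrable q t h) (μ : ℝ) : JacksonIntegrable q t fun s => g s - μ • h s := by
  refine .of_nonneg_of_le (fun _ => norm_nonneg _) (fun n => ?_) (hg.add (hh.mul_left ‖μ‖))
  rw [smul_sub, smul_comm, ← norm_smul]
  exact norm_sub_le _ _

/-- The Jackson sum `∑ j, q ^ j c_j g(t q ^ j)` with an additional weight `c` on the lattice
`t q ^ j`. All the integral operators below are of this form up to a scalar factor. -/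
def jacksonSum (q : ℝ) (c : ℕ → ℝ) (g : ℝ → E) (t : ℝ) : E :=
  ∑' j : ℕ, (q ^ j * c j) • g (t * q ^ j)

theorem jacksonSum_congr {c c' : ℕ → ℝ} {g g' : ℝ → E} {t : ℝ} (hc : ∀ j, c j = c' j)
    (hg : ∀ j : ℕ, g (t * q ^ j) = g' (t * q ^ j)) : jacksonSum q c g t = jacksonSum q c' g' t := by
  simp only [jacksonSum, hc, hg]

theorem enorm_jacksonSum_le (hq0 : 0 < q) {c : ℕ → ℝ} {K : ℝ} (hc : ∀ j, |c j| ≤ K) (g : ℝ → E)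
    (t : ℝ) :
    ‖jacksonSum q c g t‖ₑ
      ≤ ENNReal.ofReal K * ∑' j : ℕ, ENNReal.ofReal (q ^ j) * ‖g (t * q ^ j)‖ₑ := by
  rw [← ENNReal.tsum_mul_left]
  refine enorm_tsum_le_tsum_enorm.trans (ENNReal.tsum_le_tsum fun j => ?_)
  rw [enorm_smul, Real.enorm_eq_ofReal_abs, abs_mul, abs_of_pos (pow_pos hq0 j),
    ENNReal.ofReal_mul (by positivity), mul_left_comm, ← mul_assoc]
  gcongr
  exact hc j

theorem norm_jacksonSum_le (hq0 : 0 < q) (hq1 : q < 1) {c : ℕ → ℝ} {K M t : ℝ} {g : ℝ → E}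
    (hc : ∀ j, |c j| ≤ K) (hg : ∀ j : ℕ, ‖g (t * q ^ j)‖ ≤ M) :
    ‖jacksonSum q c g t‖ ≤ K * M * (1 - q)⁻¹ := by
  refine tsum_of_norm_bounded ((hasSum_geometric_of_lt_one hq0.le hq1).mul_left (K * M))
    fun j => ?_
  rw [norm_smul, Real.norm_eq_abs, abs_mul, abs_of_pos (pow_pos hq0 j), mul_assoc, mul_comm]
  exact mul_le_mul_of_nonneg_right (mul_le_mul (hc j) (hg j) (norm_nonneg _)
    ((abs_nonneg _).trans (hc j))) (by positivity)

theorem jacksonSum_const_mul (k : ℝ) (c : ℕ → ℝ) (g : ℝ → E) (t : ℝ) :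
    jacksonSum q (fun j => k * c j) g t = k • jacksonSum q c g t := by
  simp only [jacksonSum, mul_left_comm _ k, mul_smul k, tsum_const_smul'']

variable [CompleteSpace E]

theorem JacksonIntegrable.summable_smul {t K : ℝ} {g : ℝ → E} (hg : JacksonIntegrable q t g)
    {c : ℕ → ℝ} (hc : ∀ j, |c j| ≤ K) : Summable fun j : ℕ => (q ^ j * c j) • g (t * q ^ j) := by
  refine Summable.of_norm_bounded (hg.mul_left K) fun j => ?_
  rw [mul_comm, mul_smul, norm_smul, Real.norm_eq_abs]
  exact mul_le_mul_of_nonneg_right (hc j) (norm_nonneg _)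

theorem jacksonSum_sub {t K K' : ℝ} {g : ℝ → E} (hg : JacksonIntegrable q t g)
    {c c' : ℕ → ℝ} (hc : ∀ j, |c j| ≤ K) (hc' : ∀ j, |c' j| ≤ K') :
    jacksonSum q (fun j => c j - c' j) g t = jacksonSum q c g t - jacksonSum q c' g t := by
  rw [jacksonSum, jacksonSum, jacksonSum,
    ← (hg.summable_smul hc).tsum_sub (hg.summable_smul hc')]
  simp only [mul_sub, sub_smul]

theorem jacksonSum_sub_smul {t K : ℝ} {g h : ℝ → E} (hg : JacksonIntegrable q t g)
    (hh : JacksonIntegrable q t h) {c : ℕ → ℝ} (hc : ∀ j, |c j| ≤ K) (μ : ℝ) :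
    jacksonSum q c (fun s => g s - μ • h s) t = jacksonSum q c g t - μ • jacksonSum q c h t := by
  rw [jacksonSum, jacksonSum, jacksonSum, ← tsum_const_smul'',
    ← (hg.summable_smul hc).tsum_sub ((hh.summable_smul hc).const_smul μ)]
  simp only [smul_sub, smul_comm μ]

theorem jacksonSum_eq_add {t K : ℝ} {g : ℝ → E} (hg : JacksonIntegrable q t g) {c : ℕ → ℝ}
    (hc : ∀ j, |c j| ≤ K) :
    jacksonSum q c g t = c 0 • g t + q • jacksonSum q (fun j => c (j + 1)) g (q * t) := by
  rw [jacksonSum, (hg.summable_smul hc).tsum_eq_zero_add, jacksonSum, ← tsum_const_smul'']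
  simp only [pow_zero, one_mul, mul_one, smul_smul]
  congr 1
  refine tsum_congr fun j => ?_
  rw [← mul_assoc, ← pow_succ', pow_succ', mul_left_comm t, mul_assoc q t]

theorem tsum_smul_tsum_antidiagonal (a : ℕ → ℝ) (b : ℕ → ℕ → ℝ) (g : ℕ → E)
    (hs : Summable fun p : ℕ × ℕ => (a p.1 * b p.1 p.2) • g (p.1 + p.2)) :
    ∑' i, a i • ∑' j, b i j • g (i + j)
      = ∑' n, (∑ p ∈ antidiagonal n, a p.1 * b p.1 p.2) • g n := by
  calc ∑' i, a i • ∑' j, b i j • g (i + j)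
      = ∑' p : ℕ × ℕ, (a p.1 * b p.1 p.2) • g (p.1 + p.2) := by
        simp only [hs.tsum_prod, ← tsum_const_smul'', smul_smul]
    _ = ∑' n, ∑ p ∈ antidiagonal n, (a p.1 * b p.1 p.2) • g (p.1 + p.2) := by
        have hs' := Finset.HasAntidiagonal.sigmaAntidiagonalEquivProd.summable_iff.2 hs
        rw [← Finset.HasAntidiagonal.sigmaAntidiagonalEquivProd.tsum_eq (_ : ℕ × ℕ → E)]
        refine hs'.tsum_sigma.trans (tsum_congr fun n => ?_)
        rw [tsum_fintype]
        exact Finset.sum_coe_sort (antidiagonal n) fun p => (a p.1 * b p.1 p.2) • g (p.1 + p.2)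
    _ = ∑' n, (∑ p ∈ antidiagonal n, a p.1 * b p.1 p.2) • g n := by
        refine tsum_congr fun n => ?_
        rw [Finset.sum_smul]
        exact Finset.sum_congr rfl fun p hp => by rw [mem_antidiagonal.1 hp]

/-- Operators on the lattice `t q ^ j` whose weights depend on `t` through a factor `x ^ i` at
`t q ^ i` compose by a twisted Cauchy product of their weights. -/
theorem jacksonSum_comp (hq0 : 0 < q) {t x C K₁ K₂ : ℝ} (hx : 0 ≤ x) {A : ℕ → ℝ} {B : ℕ → ℕ → ℝ}
    {g h : ℝ → E}
    (hs : Summable fun p : ℕ × ℕ => x ^ p.1 * (q ^ (p.1 + p.2) * ‖g (t * q ^ (p.1 + p.2))‖))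
    (hA : ∀ i, |A i| ≤ K₁) (hB : ∀ i j, |B i j| ≤ K₂)
    (hh : ∀ i, h (t * q ^ i) = (C * x ^ i) • jacksonSum q (B i) g (t * q ^ i)) :
    jacksonSum q A h t
      = C • jacksonSum q (fun n => ∑ p ∈ antidiagonal n, A p.1 * x ^ p.1 * B p.1 p.2) g t := by
  have hsum : Summable fun p : ℕ × ℕ =>
      (q ^ p.1 * A p.1 * x ^ p.1 * (q ^ p.2 * B p.1 p.2)) • g (t * q ^ (p.1 + p.2)) := by
    refine Summable.of_norm_bounded (hs.mul_left (K₁ * K₂)) fun p => ?_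
    have factor : q ^ p.1 * A p.1 * x ^ p.1 * (q ^ p.2 * B p.1 p.2)
        = A p.1 * B p.1 p.2 * (x ^ p.1 * q ^ (p.1 + p.2)) := by ring
    rw [norm_smul, factor, norm_mul (A p.1 * B p.1 p.2), norm_mul (A p.1), mul_assoc,
      Real.norm_of_nonneg (by positivity : 0 ≤ x ^ p.1 * q ^ (p.1 + p.2)), mul_assoc (x ^ p.1)]
    refine mul_le_mul_of_nonneg_right ?_ (by positivity)
    exact mul_le_mul (hA _) (hB _ _) (abs_nonneg _) ((abs_nonneg _).trans (hA 0))
  have hcauchy := tsum_smul_tsum_antidiagonal (fun i => q ^ i * A i * x ^ i)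
    (fun i j => q ^ j * B i j) (fun n => g (t * q ^ n)) hsum
  calc jacksonSum q A h t
      = C • ∑' i, (q ^ i * A i * x ^ i) • ∑' j, (q ^ j * B i j) • g (t * q ^ (i + j)) := by
        rw [jacksonSum, ← tsum_const_smul'']
        refine tsum_congr fun i => ?_
        simp only [hh, jacksonSum, smul_smul, pow_add, ← mul_assoc]
        congr 1
        ring
    _ = _ := by
        rw [hcauchy, jacksonSum]
        congr 1
        refine tsum_congr fun n => ?_
        rw [Finset.mul_sum]
        congr 1
        refine Finset.sum_congr rfl fun p hp => ?_
        rw [← mem_antidiagonal.1 hp, pow_add]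
        ring

end JacksonSum

/-! ### Fractional `q`-integrals and their resolvents -/

section FracOp

variable {E : Type*} [NormedAddCommGroup E] [NormedSpace ℝ E] {q : ℝ}

/-- The `q`-fractional operator of real order `a` with base point `0`: for `a > 0` it is the
Riemann-Liouville `q`-integral, and for `a ≤ 0` it continues the semigroup, so that order `-n`
is the `n`-th `q`-derivative. -/
def fracOp (q a : ℝ) (g : ℝ → E) (t : ℝ) : E :=
  ((1 - q) * t) ^ a • jacksonSum q (qBinomCoeff (q ^ a) q) g t

/-- The operator `(1 + μ I_q^α)⁻¹ I_q^α`, where `I_q^α` is the `q`-fractional integral. -/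
def resolventOp (q α μ : ℝ) (g : ℝ → E) (t : ℝ) : E :=
  ((1 - q) * t) ^ α •
    jacksonSum q (resolventCoeff q (q ^ α) (q ^ α) (-μ * ((1 - q) * t) ^ α)) g t

theorem fracOp_congr {a t : ℝ} {g h : ℝ → E} (hgh : ∀ j : ℕ, g (t * q ^ j) = h (t * q ^ j)) :
    fracOp q a g t = fracOp q a h t := by
  rw [fracOp, fracOp, jacksonSum_congr (fun _ => rfl) hgh]

theorem fracOp_zero (g : ℝ → E) (t : ℝ) : fracOp q 0 g t = g t := by
  rw [fracOp, jacksonSum, tsum_eq_single 0 fun j hj => by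
    rw [Real.rpow_zero, qBinomCoeff, qPochFin_one_left, if_neg hj, zero_div, mul_zero, zero_smul]]
  simp [qBinomCoeff_zero]

theorem enorm_fracOp_le (hq0 : 0 < q) (hq1 : q < 1) (a : ℝ) {t : ℝ} (ht : 0 ≤ t) (g : ℝ → E) :
    ‖fracOp q a g t‖ₑ ≤ ENNReal.ofReal (((1 - q) * t) ^ a * qBinomBound (q ^ a) q) *
      ∑' j : ℕ, ENNReal.ofReal (q ^ j) * ‖g (t * q ^ j)‖ₑ := by
  have h0 : 0 ≤ ((1 - q) * t) ^ a := Real.rpow_nonneg (mul_nonneg (sub_pos.2 hq1).le ht) a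
  rw [fracOp, enorm_smul, Real.enorm_of_nonneg h0, ENNReal.ofReal_mul h0, mul_assoc]
  gcongr
  exact enorm_jacksonSum_le hq0 (abs_qBinomCoeff_le hq0 hq1 _) g t

theorem enorm_resolventOp_le (hq0 : 0 < q) (hq1 : q < 1) {α μ t : ℝ} (hμ : 0 ≤ μ) (ht : 0 ≤ t)
    (g : ℝ → E) :
    ‖resolventOp q α μ g t‖ₑ ≤ ENNReal.ofReal (((1 - q) * t) ^ α * qBinomBound (q ^ α) q) *
      ∑' j : ℕ, ENNReal.ofReal (q ^ j) * ‖g (t * q ^ j)‖ₑ := by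
  have h0 : 0 ≤ ((1 - q) * t) ^ α := Real.rpow_nonneg (mul_nonneg (sub_pos.2 hq1).le ht) α
  rw [resolventOp, enorm_smul, Real.enorm_of_nonneg h0, ENNReal.ofReal_mul h0, mul_assoc]
  gcongr
  exact enorm_jacksonSum_le hq0 (abs_resolventCoeff_le hq0 hq1 (Real.rpow_nonneg hq0.le α)
    (mul_nonpos_of_nonpos_of_nonneg (neg_nonpos.2 hμ) h0) _) g t

/-- A bound uniform in `μ`, because `w` times the coefficients of the resolvent of order `q ^ α`
is the difference of two bounded sequences. -/
theorem enorm_smul_resolventOp_le (hq0 : 0 < q) (hq1 : q < 1) {α μ t : ℝ} (hα : 0 ≤ α)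
    (hμ : 0 ≤ μ) (ht : 0 ≤ t) (g : ℝ → E) :
    ‖μ • resolventOp q α μ g t‖ₑ ≤ ENNReal.ofReal (2 * qBinomBound 1 q) *
      ∑' j : ℕ, ENNReal.ofReal (q ^ j) * ‖g (t * q ^ j)‖ₑ := by
  have hr0 : 0 ≤ q ^ α := Real.rpow_nonneg hq0.le α
  have hr1 : q ^ α ≤ 1 := Real.rpow_le_one hq0.le hq1.le hα
  set w := -μ * ((1 - q) * t) ^ α with hw
  have hw0 : w ≤ 0 := mul_nonpos_of_nonpos_of_nonneg (neg_nonpos.2 hμ)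
    (Real.rpow_nonneg (mul_nonneg (sub_pos.2 hq1).le ht) α)
  have coeff_le : ∀ j, |w * resolventCoeff q (q ^ α) (q ^ α) w j| ≤ 2 * qBinomBound 1 q := by
    intro j
    have h := mul_resolventCoeff (q ^ α) w 1 q
      (fun n => (one_sub_mul_pow_pos hr0 hr1 (hw0.trans_lt one_pos) n).ne') j
    rw [one_mul] at h
    rw [h, two_mul]
    exact (abs_sub _ _).trans (add_le_add (abs_resolventCoeff_le hq0 hq1 hr0 hw0 1 j)
      (abs_qBinomCoeff_le hq0 hq1 1 j))
  have h : μ • resolventOp q α μ g t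
      = -jacksonSum q (fun j => w * resolventCoeff q (q ^ α) (q ^ α) w j) g t := by
    rw [jacksonSum_const_mul, resolventOp, smul_smul, ← neg_smul, hw, neg_mul, neg_neg]
  rw [h, enorm_neg]
  exact enorm_jacksonSum_le hq0 coeff_le g t

theorem jacksonIntegrable_resolventOp (hq0 : 0 < q) (hq1 : q < 1) {α μ t M : ℝ}
    (hα : 0 ≤ α) (hμ : 0 ≤ μ) (ht : 0 ≤ t) {g : ℝ → E} (hg : ∀ n : ℕ, ‖g (t * q ^ n)‖ ≤ M) :
    JacksonIntegrable q t (resolventOp q α μ g) := by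
  have h1q : 0 ≤ 1 - q := (sub_pos.2 hq1).le
  refine jacksonIntegrable_of_bounded hq0 hq1 (M := ((1 - q) * t) ^ α *
    (qBinomBound (q ^ α) q * M * (1 - q)⁻¹)) fun n => ?_
  have hpos : 0 ≤ (1 - q) * (t * q ^ n) := by positivity
  have hw : -μ * ((1 - q) * (t * q ^ n)) ^ α ≤ 0 :=
    mul_nonpos_of_nonpos_of_nonneg (neg_nonpos.2 hμ) (Real.rpow_nonneg hpos α)
  rw [resolventOp, norm_smul, Real.norm_of_nonneg (Real.rpow_nonneg hpos α)]
  refine mul_le_mul (Real.rpow_le_rpow hpos ?_ hα) ?_ (norm_nonneg _) (by positivity)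
  · exact mul_le_mul_of_nonneg_left
      (mul_le_of_le_one_right ht (pow_le_one₀ hq0.le hq1.le)) h1q
  · refine norm_jacksonSum_le hq0 hq1
      (abs_resolventCoeff_le hq0 hq1 (Real.rpow_nonneg hq0.le α) hw (q ^ α)) fun j => ?_
    rw [mul_assoc, ← pow_add]
    exact hg _

theorem tendsto_qDeriv (hq0 : 0 < q) (hq1 : q < 1) {t : ℝ} (ht : 0 < t) {v : ℝ → E} {ρ : E}
    (hρ : Tendsto (fun n : ℕ => (t * q ^ n)⁻¹ • (v (t * q ^ n) - v 0)) atTop (𝓝 ρ)) :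
    Tendsto (fun n : ℕ => qDeriv q v (t * q ^ n)) atTop (𝓝 ρ) := by
  have h1q : 1 - q ≠ 0 := (sub_pos.2 hq1).ne'
  have h := (hρ.sub ((hρ.comp (tendsto_add_atTop_nat 1)).const_smul q)).const_smul (1 - q)⁻¹
  rw [show (1 - q)⁻¹ • (ρ - q • ρ) = ρ by
    rw [inv_smul_eq_iff₀ h1q, sub_smul, one_smul]] at h
  refine h.congr fun n => ?_
  have hinv : q * (t * q ^ (n + 1))⁻¹ = (t * q ^ n)⁻¹ := by
    rw [pow_succ]; field_simp
  rw [Function.comp_apply, smul_smul q, hinv, ← smul_sub, smul_smul, ← mul_inv, mul_comm (1 - q),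
    sub_sub_sub_cancel_right, qDeriv, mul_left_comm q, ← pow_succ']

theorem tendsto_of_tendsto_quotient (hq0 : 0 < q) (hq1 : q < 1) {t : ℝ} (ht : 0 < t) {v : ℝ → E}
    {ρ : E} (hρ : Tendsto (fun n : ℕ => (t * q ^ n)⁻¹ • (v (t * q ^ n) - v 0)) atTop (𝓝 ρ)) :
    Tendsto (fun n : ℕ => v (t * q ^ n)) atTop (𝓝 (v 0)) := by
  have h := (((tendsto_pow_atTop_nhds_zero_of_lt_one hq0.le hq1).const_mul t).smul hρ).add_const
    (v 0)
  rw [mul_zero, zero_smul, zero_add] at h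
  refine h.congr fun n => ?_
  rw [smul_inv_smul₀ (by positivity), sub_add_cancel]

variable [CompleteSpace E]

theorem fracOp_sub_smul (hq0 : 0 < q) (hq1 : q < 1) (a μ : ℝ) {t : ℝ} {g h : ℝ → E}
    (hg : JacksonIntegrable q t g) (hh : JacksonIntegrable q t h) :
    fracOp q a (fun s => g s - μ • h s) t = fracOp q a g t - μ • fracOp q a h t := by
  rw [fracOp, fracOp, fracOp, jacksonSum_sub_smul hg hh (abs_qBinomCoeff_le hq0 hq1 _),
    smul_sub, smul_comm μ]

theorem fracOp_fracOp (hq0 : 0 < q) (hq1 : q < 1) (a b : ℝ) {t : ℝ} (ht : 0 < t) {g : ℝ → E}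
    (hs : Summable fun p : ℕ × ℕ =>
      (q ^ b) ^ p.1 * (q ^ (p.1 + p.2) * ‖g (t * q ^ (p.1 + p.2))‖)) :
    fracOp q a (fracOp q b g) t = fracOp q (a + b) g t := by
  have hs0 : 0 < (1 - q) * t := mul_pos (sub_pos.2 hq1) ht
  rw [fracOp, jacksonSum_comp (C := ((1 - q) * t) ^ b) hq0 (by positivity) hs
    (abs_qBinomCoeff_le hq0 hq1 _) (fun _ => abs_qBinomCoeff_le hq0 hq1 _)
    fun i => by rw [fracOp, ← mul_assoc, mul_pow_rpow hq0 hs0.le],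
    smul_smul, ← Real.rpow_add hs0, fracOp, Real.rpow_add hq0]
  congr 1
  exact jacksonSum_congr (qVandermonde (pow_succ_ne_one hq0 hq1) _ _) fun _ => rfl

theorem qDeriv_fracOp (hq0 : 0 < q) (hq1 : q < 1) (a : ℝ) {t : ℝ} (ht : 0 < t) {g : ℝ → E}
    (hg : JacksonIntegrable q t g) : qDeriv q (fracOp q a g) t = fracOp q (a - 1) g t := by
  have hs0 : 0 < (1 - q) * t := mul_pos (sub_pos.2 hq1) ht
  have hg' : JacksonIntegrable q (q * t) g := by
    simpa [mul_comm] using hg.mul_pow hq0 1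
  have hqa : q ^ a = q * q ^ (a - 1) := by
    rw [Real.rpow_sub_one hq0.ne', mul_div_cancel₀ _ hq0.ne']
  have hsa : ((1 - q) * t) ^ a = ((1 - q) * t) * ((1 - q) * t) ^ (a - 1) := by
    rw [Real.rpow_sub_one hs0.ne', mul_div_cancel₀ _ hs0.ne']
  have hqsa : ((1 - q) * (q * t)) ^ a = q ^ a * ((1 - q) * t) ^ a := by
    rw [mul_left_comm, Real.mul_rpow hq0.le hs0.le]
  have coeff_succ : jacksonSum q (fun j => qBinomCoeff (q ^ (a - 1)) q (j + 1)) g (q * t)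
      = jacksonSum q (fun j => qBinomCoeff (q ^ a) q (j + 1)) g (q * t)
        - q ^ (a - 1) • jacksonSum q (qBinomCoeff (q ^ a) q) g (q * t) := by
    rw [← jacksonSum_const_mul, ← jacksonSum_sub hg' (fun j => abs_qBinomCoeff_le hq0 hq1 _ _)
      (K' := |q ^ (a - 1)| * qBinomBound (q ^ a) q) fun j => by
        rw [abs_mul]; gcongr; exact abs_qBinomCoeff_le hq0 hq1 _ j]
    refine jacksonSum_congr (fun j => ?_) fun _ => rfl
    rw [hqa, mul_comm q, qBinomCoeff_succ_sub (pow_succ_ne_one hq0 hq1)]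
  rw [qDeriv, fracOp, fracOp, fracOp, jacksonSum_eq_add hg (abs_qBinomCoeff_le hq0 hq1 (q ^ a)),
    jacksonSum_eq_add hg (abs_qBinomCoeff_le hq0 hq1 (q ^ (a - 1))), coeff_succ, hqsa, hsa,
    qBinomCoeff_zero, qBinomCoeff_zero, mul_comm t, inv_smul_eq_iff₀ hs0.ne', hqa]
  module

theorem fracOp_one_qDeriv (hq0 : 0 < q) (hq1 : q < 1) {t : ℝ} (ht : 0 < t) {v : ℝ → E} {ℓ : E}
    (hv : JacksonIntegrable q t (qDeriv q v))
    (hℓ : Tendsto (fun n : ℕ => v (t * q ^ n)) atTop (𝓝 ℓ)) :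
    fracOp q 1 (qDeriv q v) t = v t - ℓ := by
  have h1q : 1 - q ≠ 0 := (sub_pos.2 hq1).ne'
  have coeff_eq_one : ∀ j, qBinomCoeff q q j = 1 := fun j =>
    div_self (qPochFin_self_ne_zero (pow_succ_ne_one hq0 hq1) j)
  have term : ∀ j : ℕ, ((1 - q) * t) • (q ^ j * qBinomCoeff q q j) • qDeriv q v (t * q ^ j)
      = v (t * q ^ j) - v (t * q ^ (j + 1)) := fun j => by
    rw [qDeriv, coeff_eq_one, smul_smul, smul_smul, mul_left_comm q, ← pow_succ',
      show (1 - q) * t * (q ^ j * 1) * (t * q ^ j * (1 - q))⁻¹ = 1 by field_simp, one_smul]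
  have hsum := ((hv.summable_smul fun j => (congrArg abs (coeff_eq_one j)).le).const_smul
    ((1 - q) * t)).hasSum.tendsto_sum_nat
  simp only [term, Finset.sum_range_sub', pow_zero, mul_one] at hsum
  rw [fracOp, Real.rpow_one, Real.rpow_one, jacksonSum, ← tsum_const_smul'']
  simp only [term]
  exact tendsto_nhds_unique hsum (hℓ.const_sub _)

theorem fracOp_two_qDeriv (hq0 : 0 < q) (hq1 : q < 1) {t : ℝ} (ht : 0 < t) {v : ℝ → E} {ρ : E}
    (hv : JacksonIntegrable q t ((qDeriv q)^[2] v))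
    (hρ : Tendsto (fun n : ℕ => (t * q ^ n)⁻¹ • (v (t * q ^ n) - v 0)) atTop (𝓝 ρ)) :
    fracOp q 2 ((qDeriv q)^[2] v) t = v t - v 0 - t • ρ := by
  have hDv := tendsto_qDeriv hq0 hq1 ht hρ
  have qDeriv_sub : ∀ j : ℕ, qDeriv q (fun s => v s - s • ρ) (t * q ^ j)
      = qDeriv q v (t * q ^ j) - ρ := fun j => by
    have hs : t * q ^ j * (1 - q) ≠ 0 := (mul_pos (by positivity) (sub_pos.2 hq1)).ne'
    rw [qDeriv, qDeriv, inv_smul_eq_iff₀ hs, smul_sub, smul_inv_smul₀ hs]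
    module
  have inner_integral : ∀ j : ℕ, fracOp q 1 ((qDeriv q)^[2] v) (t * q ^ j)
      = qDeriv q (fun s => v s - s • ρ) (t * q ^ j) := fun j => by
    rw [qDeriv_sub]
    refine fracOp_one_qDeriv hq0 hq1 (by positivity) (hv.mul_pow hq0 j) ?_
    refine (hDv.comp (tendsto_add_atTop_nat j)).congr fun n => ?_
    rw [Function.comp_apply, add_comm, pow_add, mul_assoc]
  have integrable : JacksonIntegrable q t (qDeriv q fun s => v s - s • ρ) := by
    obtain ⟨M, hM⟩ := (hDv.sub_const ρ).norm.bddAbove_range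
    exact jacksonIntegrable_of_bounded hq0 hq1 fun n => by
      rw [qDeriv_sub]; exact hM (Set.mem_range_self n)
  have limit : Tendsto (fun n : ℕ => v (t * q ^ n) - (t * q ^ n) • ρ) atTop (𝓝 (v 0)) := by
    have h := (tendsto_of_tendsto_quotient hq0 hq1 ht hρ).sub
      (((tendsto_pow_atTop_nhds_zero_of_lt_one hq0.le hq1).const_mul t).smul_const ρ)
    simpa using h
  have hs := summable_antidiagonal_of_summable (x := q ^ (1 : ℝ)) (by positivity)
    (by rwa [Real.rpow_one]) (fun n => by positivity) ((jacksonIntegrable_iff hq0).1 hv)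
  rw [show (2 : ℝ) = 1 + 1 by norm_num, ← fracOp_fracOp hq0 hq1 1 1 ht hs,
    fracOp_congr inner_integral, fracOp_one_qDeriv hq0 hq1 ht integrable limit, sub_right_comm]

theorem eq_add_fracOp_of_caputo (hq0 : 0 < q) (hq1 : q < 1) {α : ℝ} (hα2 : α < 2) {t : ℝ}
    (ht : 0 < t) {v F : ℝ → E} {ρ : E} (hv : JacksonIntegrable q t ((qDeriv q)^[2] v))
    (hρ : Tendsto (fun n : ℕ => (t * q ^ n)⁻¹ • (v (t * q ^ n) - v 0)) atTop (𝓝 ρ))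
    (hF : ∀ n : ℕ, fracOp q (2 - α) ((qDeriv q)^[2] v) (t * q ^ n) = F (t * q ^ n)) :
    v t = v 0 + t • ρ + fracOp q α F t := by
  have hs := summable_antidiagonal_of_summable (x := q ^ (2 - α)) (by positivity)
    (Real.rpow_lt_one hq0.le hq1 (sub_pos.2 hα2)) (fun n => by positivity)
    ((jacksonIntegrable_iff hq0).1 hv)
  rw [← fracOp_congr hF, fracOp_fracOp hq0 hq1 α (2 - α) ht hs, add_sub_cancel,
    fracOp_two_qDeriv hq0 hq1 ht hv hρ]
  abel

theorem qDeriv_two_add_smul_add_fracOp (hq0 : 0 < q) (hq1 : q < 1) {α T : ℝ} {x y : E}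
    {G u : ℝ → E} (hG : ∀ t ∈ Set.Ioc 0 T, JacksonIntegrable q t G)
    (hu : ∀ t ∈ Set.Ioc 0 T, u t = x + t • y + fracOp q α G t) {t : ℝ} (ht : t ∈ Set.Ioc 0 T) :
    (qDeriv q)^[2] u t = fracOp q (α - 2) G t := by
  have hqt : ∀ s ∈ Set.Ioc 0 T, q * s ∈ Set.Ioc 0 T := fun s hs => by
    simpa [mul_comm] using mem_Ioc_mul_pow hq0 hq1 hs 1
  have first : ∀ s ∈ Set.Ioc 0 T, qDeriv q u s = y + fracOp q (α - 1) G s := fun s hs => by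
    have hs0 : s * (1 - q) ≠ 0 := (mul_pos hs.1 (sub_pos.2 hq1)).ne'
    rw [← qDeriv_fracOp hq0 hq1 α hs.1 (hG s hs), qDeriv, qDeriv, hu s hs, hu _ (hqt s hs),
      inv_smul_eq_iff₀ hs0, smul_add, smul_inv_smul₀ hs0]
    module
  change qDeriv q (qDeriv q u) t = _
  rw [show α - 2 = α - 1 - 1 by ring, ← qDeriv_fracOp hq0 hq1 (α - 1) ht.1 (hG t ht), qDeriv,
    first t ht, first _ (hqt t ht), qDeriv, add_sub_add_left_eq_sub]

end FracOp

section ResolventOp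

variable {E : Type*} [NormedAddCommGroup E] [NormedSpace ℝ E] [CompleteSpace E] {q α μ t : ℝ}

theorem fracOp_resolventOp (hq0 : 0 < q) (hq1 : q < 1) (hα : 0 < α) (hμ : 0 ≤ μ) (ht : 0 ≤ t)
    {g : ℝ → E} (hg : JacksonIntegrable q t g) :
    fracOp q α (resolventOp q α μ g) t = ((1 - q) * t) ^ α • ((1 - q) * t) ^ α •
      jacksonSum q (resolventCoeff q (q ^ α) (q ^ α * q ^ α) (-μ * ((1 - q) * t) ^ α)) g t := by
  have hs0 : 0 ≤ (1 - q) * t := mul_nonneg (sub_pos.2 hq1).le ht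
  have hr0 : 0 ≤ q ^ α := Real.rpow_nonneg hq0.le α
  have hs := summable_antidiagonal_of_summable hr0 (Real.rpow_lt_one hq0.le hq1 hα)
    (fun n => by positivity) ((jacksonIntegrable_iff hq0).1 hg)
  set c := ((1 - q) * t) ^ α
  have hw : -μ * c ≤ 0 := mul_nonpos_of_nonpos_of_nonneg (neg_nonpos.2 hμ)
    (Real.rpow_nonneg hs0 α)
  have dilate : ∀ i : ℕ, resolventOp q α μ g (t * q ^ i) = (c * (q ^ α) ^ i) •
      jacksonSum q (resolventCoeff q (q ^ α) (q ^ α) (-μ * c * (q ^ α) ^ i)) g (t * q ^ i) :=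
    fun i => by rw [resolventOp, ← mul_assoc, mul_pow_rpow hq0 hs0, mul_assoc (-μ)]
  have hcomp := jacksonSum_comp hq0 hr0 hs (abs_qBinomCoeff_le hq0 hq1 (q ^ α))
    (fun i => abs_resolventCoeff_le hq0 hq1 hr0
      (mul_nonpos_of_nonpos_of_nonneg hw (pow_nonneg hr0 i)) (q ^ α)) dilate
  rw [fracOp, hcomp, jacksonSum_congr
    (qVandermonde_resolventCoeff (q ^ α) (-μ * c) (pow_succ_ne_one hq0 hq1) (q ^ α) (q ^ α))
    fun _ => rfl]

theorem resolventOp_fracOp (hq0 : 0 < q) (hq1 : q < 1) (hα : 0 < α) (hμ : 0 ≤ μ) (ht : 0 ≤ t)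
    {g : ℝ → E} (hg : JacksonIntegrable q t g) :
    resolventOp q α μ (fracOp q α g) t = fracOp q α (resolventOp q α μ g) t := by
  have hs0 : 0 ≤ (1 - q) * t := mul_nonneg (sub_pos.2 hq1).le ht
  have hr0 : 0 ≤ q ^ α := Real.rpow_nonneg hq0.le α
  have hs := summable_antidiagonal_of_summable hr0 (Real.rpow_lt_one hq0.le hq1 hα)
    (fun n => by positivity) ((jacksonIntegrable_iff hq0).1 hg)
  rw [fracOp_resolventOp hq0 hq1 hα hμ ht hg, resolventOp]
  set c := ((1 - q) * t) ^ α
  have hw : -μ * c ≤ 0 := mul_nonpos_of_nonpos_of_nonneg (neg_nonpos.2 hμ)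
    (Real.rpow_nonneg hs0 α)
  have dilate : ∀ i : ℕ, fracOp q α g (t * q ^ i) = (c * (q ^ α) ^ i) •
      jacksonSum q (qBinomCoeff (q ^ α) q) g (t * q ^ i) :=
    fun i => by rw [fracOp, ← mul_assoc, mul_pow_rpow hq0 hs0]
  have hcomp := jacksonSum_comp hq0 hr0 hs (abs_resolventCoeff_le hq0 hq1 hr0 hw (q ^ α))
    (fun _ => abs_qBinomCoeff_le hq0 hq1 (q ^ α)) dilate
  rw [hcomp, jacksonSum_congr
    (qVandermonde_resolventCoeff' (q ^ α) (-μ * c) (pow_succ_ne_one hq0 hq1) (q ^ α) (q ^ α))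
    fun _ => rfl]

theorem resolventOp_eq_sub (hq0 : 0 < q) (hq1 : q < 1) (hα : 0 < α) (hμ : 0 ≤ μ) (ht : 0 ≤ t)
    {g : ℝ → E} (hg : JacksonIntegrable q t g) :
    resolventOp q α μ g t = fracOp q α g t - μ • fracOp q α (resolventOp q α μ g) t := by
  have hr0 : 0 ≤ q ^ α := Real.rpow_nonneg hq0.le α
  have hr1 : q ^ α ≤ 1 := Real.rpow_le_one hq0.le hq1.le hα.le
  rw [fracOp_resolventOp hq0 hq1 hα hμ ht hg, resolventOp, fracOp]
  set s := ((1 - q) * t) ^ α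
  set w := -μ * s with hw
  have hw0 : w ≤ 0 := mul_nonpos_of_nonpos_of_nonneg (by linarith)
    (Real.rpow_nonneg (mul_nonneg (sub_pos.2 hq1).le ht) α)
  have resolvent_identity :
      w • jacksonSum q (resolventCoeff q (q ^ α) (q ^ α * q ^ α) w) g t
        = jacksonSum q (resolventCoeff q (q ^ α) (q ^ α) w) g t
          - jacksonSum q (qBinomCoeff (q ^ α) q) g t := by
    rw [← jacksonSum_const_mul, ← jacksonSum_sub hg
      (abs_resolventCoeff_le hq0 hq1 hr0 hw0 _) (abs_qBinomCoeff_le hq0 hq1 _)]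
    exact jacksonSum_congr (mul_resolventCoeff _ _ _ _ fun n =>
      (one_sub_mul_pow_pos hr0 hr1 (hw0.trans_lt one_pos) n).ne') fun _ => rfl
  rw [← sub_add_cancel (jacksonSum q (resolventCoeff q (q ^ α) (q ^ α) w) g t)
    (jacksonSum q (qBinomCoeff (q ^ α) q) g t), ← resolvent_identity, hw]
  module

theorem resolventOp_volterra (hq0 : 0 < q) (hq1 : q < 1) (hα : 0 < α) (hμ : 0 ≤ μ) (ht : 0 ≤ t)
    {M : ℝ} {g : ℝ → E} (hg : ∀ n : ℕ, ‖g (t * q ^ n)‖ ≤ M) :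
    resolventOp q α μ g t = fracOp q α (fun s => g s - μ • resolventOp q α μ g s) t := by
  have hint := jacksonIntegrable_of_bounded hq0 hq1 hg
  rw [fracOp_sub_smul hq0 hq1 α μ hint (jacksonIntegrable_resolventOp hq0 hq1 hα.le hμ ht hg)]
  exact resolventOp_eq_sub hq0 hq1 hα hμ ht hint

/-- Since the resolvent commutes with `I_q^α`, applying it to `d = -μ I_q^α d` gives
`I_q^α d = 0`. -/
theorem eq_zero_of_eq_neg_smul_fracOp (hq0 : 0 < q) (hq1 : q < 1) (hα : 0 < α) (hμ : 0 ≤ μ)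
    (ht : 0 ≤ t) {d : ℝ → E} (hint : JacksonIntegrable q t d)
    (hd : ∀ n : ℕ, d (t * q ^ n) = -μ • fracOp q α d (t * q ^ n)) : d t = 0 := by
  have apply_resolvent : resolventOp q α μ d t = -μ • fracOp q α (resolventOp q α μ d) t := by
    rw [← resolventOp_fracOp hq0 hq1 hα hμ ht hint, resolventOp, resolventOp, smul_comm (-μ),
      jacksonSum_congr (fun _ => rfl) (g' := fun s => -μ • fracOp q α d s) hd]
    simp only [jacksonSum, smul_comm _ (-μ), tsum_const_smul'']
  rw [resolventOp_eq_sub hq0 hq1 hα hμ ht hint, neg_smul, sub_eq_neg_self] at apply_resolvent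
  simpa [apply_resolvent] using hd 0

theorem volterra_unique (hq0 : 0 < q) (hq1 : q < 1) (hα : 0 < α) (hμ : 0 ≤ μ) (ht : 0 ≤ t)
    {x F u v : ℝ → E} (hF : JacksonIntegrable q t F) (hu : JacksonIntegrable q t u)
    (hv : JacksonIntegrable q t v)
    (hFu : ∀ n : ℕ, u (t * q ^ n)
      = x (t * q ^ n) + fracOp q α (fun s => F s - μ • u s) (t * q ^ n))
    (hFv : ∀ n : ℕ, v (t * q ^ n)
      = x (t * q ^ n) + fracOp q α (fun s => F s - μ • v s) (t * q ^ n)) : u t = v t := by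
  have difference : u t - (1 : ℝ) • v t = 0 := by
    refine eq_zero_of_eq_neg_smul_fracOp (d := fun s => u s - (1 : ℝ) • v s) hq0 hq1 hα hμ ht
      (hu.sub_smul hv 1) fun n => ?_
    have hF' := hF.mul_pow hq0 n
    have hu' := hu.mul_pow hq0 n
    have hv' := hv.mul_pow hq0 n
    rw [fracOp_sub_smul hq0 hq1 α 1 hu' hv', hFu, hFv, fracOp_sub_smul hq0 hq1 α μ hF' hu',
      fracOp_sub_smul hq0 hq1 α μ hF' hv']
    module
  rwa [one_smul, sub_eq_zero] at difference

end ResolventOp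

/-! ### The Sobolev norms -/

section L2ENorm

variable {ι κ : Type*}

/-- The `ℓ²` norm of a family in `[0, ∞]`. The Sobolev norms are `ℓ²` norms of weighted families
of Fourier coefficients. -/
def l2ENorm (f : ι → ℝ≥0∞) : ℝ≥0∞ := (∑' k, f k ^ 2) ^ (1 / 2 : ℝ)

theorem l2ENorm_sq (f : ι → ℝ≥0∞) : l2ENorm f ^ 2 = ∑' k, f k ^ 2 := by
  rw [l2ENorm, ← ENNReal.rpow_natCast, ← ENNReal.rpow_mul]
  norm_num

theorem l2ENorm_mono {f g : ι → ℝ≥0∞} (h : ∀ k, f k ≤ g k) : l2ENorm f ≤ l2ENorm g := by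
  rw [l2ENorm, l2ENorm]
  gcongr with k
  exact h k

theorem le_l2ENorm (f : ι → ℝ≥0∞) (k : ι) : f k ≤ l2ENorm f := by
  rw [← ENNReal.pow_le_pow_left_iff two_ne_zero, l2ENorm_sq]
  exact ENNReal.le_tsum (f := fun k => f k ^ 2) k

theorem l2ENorm_const_mul (a : ℝ≥0∞) (f : ι → ℝ≥0∞) :
    l2ENorm (fun k => a * f k) = a * l2ENorm f := by
  refine (ENNReal.pow_right_strictMono two_ne_zero).injective ?_
  simp only [mul_pow, l2ENorm_sq, ENNReal.tsum_mul_left]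

theorem tsum_mul_le_l2ENorm_mul (f g : ι → ℝ≥0∞) :
    ∑' k, f k * g k ≤ l2ENorm f * l2ENorm g := by
  let _ : MeasurableSpace ι := ⊤
  have h := ENNReal.lintegral_mul_le_Lp_mul_Lq MeasureTheory.Measure.count
    Real.HolderConjugate.two_two (measurable_from_top (f := f)).aemeasurable
    (measurable_from_top (f := g)).aemeasurable
  simpa only [l2ENorm, MeasureTheory.lintegral_count, Pi.mul_apply, ENNReal.rpow_ofNat] using h

theorem l2ENorm_tsum_le (f : κ → ι → ℝ≥0∞) :
    l2ENorm (fun k => ∑' j, f j k) ≤ ∑' j, l2ENorm (f j) := by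
  rw [← ENNReal.pow_le_pow_left_iff two_ne_zero, l2ENorm_sq]
  simp only [sq, ← ENNReal.tsum_mul_left, ← ENNReal.tsum_mul_right]
  calc ∑' k, ∑' i, ∑' j, f j k * f i k = ∑' i, ∑' j, ∑' k, f j k * f i k := by
        rw [ENNReal.tsum_comm]
        exact tsum_congr fun i => ENNReal.tsum_comm
    _ ≤ ∑' i, ∑' j, l2ENorm (f j) * l2ENorm (f i) := by
        gcongr
        exact tsum_mul_le_l2ENorm_mul _ _

end L2ENorm

namespace PositiveOperator

variable {𝕜 H I : Type*} [RCLike 𝕜] [NormedAddCommGroup H] [InnerProductSpace 𝕜 H]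
  [CompleteSpace H] (L : PositiveOperator 𝕜 H I)

theorem one_add_eigenvalue_pos (k : I) : 0 < 1 + L.eigenvalue k := by
  linarith [L.eigenvalue_nonneg k]

theorem eNorm_eq_l2ENorm (d : ℝ) (c : I → 𝕜) :
    L.eNorm d c = l2ENorm fun k => ENNReal.ofReal ((1 + L.eigenvalue k) ^ (d / 2)) * ‖c k‖ₑ := by
  rw [eNorm, l2ENorm]
  congr 1
  refine tsum_congr fun k => ?_
  have hk := L.one_add_eigenvalue_pos k
  rw [mul_pow, ← ENNReal.ofReal_pow (by positivity), ← Real.rpow_mul_natCast hk.le,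
    Nat.cast_ofNat, div_mul_cancel₀ d two_ne_zero]

theorem eNorm_le_mul_of_norm_le {d d' : ℝ} {K : ℝ≥0} {a b : I → 𝕜}
    (h : ∀ k, (1 + L.eigenvalue k) ^ ((d - d') / 2) * ‖a k‖ ≤ K * ‖b k‖) :
    L.eNorm d a ≤ K * L.eNorm d' b := by
  rw [eNorm_eq_l2ENorm, eNorm_eq_l2ENorm, ← l2ENorm_const_mul]
  refine l2ENorm_mono fun k => ?_
  have hk := L.one_add_eigenvalue_pos k
  have weight : (1 + L.eigenvalue k) ^ (d / 2)
      = (1 + L.eigenvalue k) ^ (d' / 2) * (1 + L.eigenvalue k) ^ ((d - d') / 2) := by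
    rw [← Real.rpow_add hk]
    ring_nf
  rw [mul_left_comm, weight, ENNReal.ofReal_mul (by positivity), mul_assoc]
  refine mul_le_mul_right ?_ _
  rw [← ofReal_norm, ← ofReal_norm, ← ENNReal.ofReal_mul (by positivity),
    ← ENNReal.ofReal_coe_nnreal, ← ENNReal.ofReal_mul (by positivity)]
  exact ENNReal.ofReal_le_ofReal (h k)

theorem eNorm_smul (d r : ℝ) (c : I → 𝕜) : L.eNorm d (r • c) = ‖r‖ₑ * L.eNorm d c := by
  rw [eNorm_eq_l2ENorm, eNorm_eq_l2ENorm, ← l2ENorm_const_mul]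
  simp only [Pi.smul_apply, enorm_smul, mul_left_comm]

theorem eNorm_le_tsum (d : ℝ) {κ : Type*} {c : I → 𝕜} {a : κ → ℝ≥0∞} {g : κ → I → 𝕜}
    (h : ∀ k, ‖c k‖ₑ ≤ ∑' j, a j * ‖g j k‖ₑ) : L.eNorm d c ≤ ∑' j, a j * L.eNorm d (g j) := by
  simp only [eNorm_eq_l2ENorm, ← l2ENorm_const_mul]
  refine (l2ENorm_mono fun k => ?_).trans (l2ENorm_tsum_le _)
  simp only [mul_left_comm (a _), ENNReal.tsum_mul_left]
  gcongr
  exact h k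

theorem eNorm_add_le (d : ℝ) (a b : I → 𝕜) :
    L.eNorm d (a + b) ≤ L.eNorm d a + L.eNorm d b := by
  have h := L.eNorm_le_tsum d (c := a + b) (a := fun _ : Bool => 1) (g := fun i => cond i a b)
    fun k => by simpa using enorm_add_le (a k) (b k)
  simpa using h

theorem eNorm_sub_le (d : ℝ) (a b : I → 𝕜) :
    L.eNorm d (a - b) ≤ L.eNorm d a + L.eNorm d b := by
  have h := L.eNorm_add_le d a ((-1 : ℝ) • b)
  rw [eNorm_smul, enorm_neg, enorm_one, one_mul] at h
  simpa [sub_eq_add_neg] using h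

theorem eNorm_le_of_enorm_le_tsum {q : ℝ} (hq0 : 0 < q) (hq1 : q < 1) {d : ℝ} {c : I → 𝕜}
    {g : ℕ → I → 𝕜} {A M : ℝ≥0∞} (hM : ∀ j, L.eNorm d (g j) ≤ M)
    (h : ∀ k, ‖c k‖ₑ ≤ A * ∑' j : ℕ, ENNReal.ofReal (q ^ j) * ‖g j k‖ₑ) :
    L.eNorm d c ≤ A * (ENNReal.ofReal (1 - q)⁻¹ * M) := by
  have geometric : ∑' j : ℕ, ENNReal.ofReal (q ^ j) = ENNReal.ofReal (1 - q)⁻¹ := by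
    rw [← tsum_geometric_of_lt_one hq0.le hq1, ENNReal.ofReal_tsum_of_nonneg
      (fun j => by positivity) (summable_geometric_of_lt_one hq0.le hq1)]
  simp only [← ENNReal.tsum_mul_left, ← mul_assoc] at h
  refine (L.eNorm_le_tsum d h).trans ?_
  simp only [mul_assoc, ENNReal.tsum_mul_left, ← geometric, ← ENNReal.tsum_mul_right]
  gcongr
  exact hM _

theorem enorm_apply_le (d : ℝ) (c : I → 𝕜) (k : I) :
    ‖c k‖ₑ ≤ ENNReal.ofReal ((1 + L.eigenvalue k) ^ (-(d / 2))) * L.eNorm d c := by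
  have hk := L.one_add_eigenvalue_pos k
  calc ‖c k‖ₑ = ENNReal.ofReal ((1 + L.eigenvalue k) ^ (-(d / 2))) *
        (ENNReal.ofReal ((1 + L.eigenvalue k) ^ (d / 2)) * ‖c k‖ₑ) := by
        rw [← mul_assoc, ← ENNReal.ofReal_mul (by positivity), ← Real.rpow_add hk,
          neg_add_cancel, Real.rpow_zero, ENNReal.ofReal_one, one_mul]
    _ ≤ _ := by
        gcongr
        rw [eNorm_eq_l2ENorm]
        exact le_l2ENorm (fun k => ENNReal.ofReal ((1 + L.eigenvalue k) ^ (d / 2)) * ‖c k‖ₑ) k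

theorem exists_norm_apply_le (d : ℝ) (k : I) {M : ℝ≥0∞} (hM : M < ∞) :
    ∃ B : ℝ, ∀ c : I → 𝕜, L.eNorm d c ≤ M → ‖c k‖ ≤ B := by
  refine ⟨(ENNReal.ofReal ((1 + L.eigenvalue k) ^ (-(d / 2))) * M).toReal, fun c hc => ?_⟩
  rw [← toReal_enorm]
  refine ENNReal.toReal_mono (ENNReal.mul_ne_top ENNReal.ofReal_ne_top hM.ne) ?_
  exact (L.enorm_apply_le d c k).trans (by gcongr)

theorem summable_norm_apply {d : ℝ} {c : ℕ → I → 𝕜} (h : ∑' n, L.eNorm d (c n) < ∞) (k : I) :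
    Summable fun n => ‖c n k‖ := by
  have finite : ∑' n, ‖c n k‖ₑ ≠ ∞ := by
    refine ne_top_of_le_ne_top (ENNReal.mul_ne_top (ENNReal.ofReal_ne_top
      (r := (1 + L.eigenvalue k) ^ (-(d / 2)))) h.ne) ?_
    rw [← ENNReal.tsum_mul_left]
    exact ENNReal.tsum_le_tsum fun n => L.enorm_apply_le d (c n) k
  simpa using ENNReal.summable_toReal finite

theorem tendsto_apply_of_eNorm {d : ℝ} {c : ℕ → I → 𝕜} {ρ : I → 𝕜}
    (h : Tendsto (fun n => L.eNorm d (c n - ρ)) atTop (𝓝 0)) (k : I) :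
    Tendsto (fun n => c n k) atTop (𝓝 (ρ k)) := by
  rw [tendsto_iff_edist_tendsto_0]
  have bound := ENNReal.Tendsto.const_mul h
    (Or.inr (ENNReal.ofReal_ne_top (r := (1 + L.eigenvalue k) ^ (-(d / 2)))))
  rw [mul_zero] at bound
  refine tendsto_of_tendsto_of_tendsto_of_le_of_le tendsto_const_nhds bound (fun _ => zero_le)
    fun n => ?_
  rw [edist_eq_enorm_sub]
  exact L.enorm_apply_le d (c n - ρ) k

end PositiveOperator

/-! ### The Caputo derivative -/

section Kernel

variable {E : Type*} [NormedAddCommGroup E] [NormedSpace ℝ E] {q : ℝ}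

theorem rlIntegral_eq_fracOp (hq0 : 0 < q) (hq1 : q < 1) {a t : ℝ} (ha : 0 < a) (ht : 0 < t)
    (g : ℝ → E) : rlIntegral q a g t = fracOp q a g t := by
  have hΓ := (qGamma_pos hq0 hq1 ha).ne'
  have h1q : 1 - q ≠ 0 := (sub_pos.2 hq1).ne'
  have lattice : jacksonIntegral q t (fun s => qPowKernel q (a - 1) t s • g s)
      = ((1 - q) * t) • (qGamma q a * ((1 - q) * t) ^ (a - 1)) •
        jacksonSum q (qBinomCoeff (q ^ a) q) g t := by
    have term : ∀ n : ℕ, q ^ n • qPowKernel q (a - 1) t (t * q ^ n) • g (t * q ^ n)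
        = (qGamma q a * ((1 - q) * t) ^ (a - 1)) •
          (q ^ n * qBinomCoeff (q ^ a) q n) • g (t * q ^ n) := fun n => by
      rw [qPowKernel_lattice hq0 hq1 ha ht, smul_smul, smul_smul, mul_left_comm]
    simp only [jacksonIntegral, jacksonSum, term]
    rw [tsum_const_smul'']
  rw [rlIntegral, lattice, fracOp, smul_smul, smul_smul,
    Real.rpow_sub_one (mul_ne_zero h1q ht.ne')]
  congr 1
  field_simp

theorem abs_qPowKernel_lattice_le (hq0 : 0 < q) (hq1 : q < 1) {β t : ℝ} (hβ : 0 < β) (ht : 0 < t)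
    (n : ℕ) : |qPowKernel q (β - 1) t (t * q ^ n)|
      ≤ qGamma q β * ((1 - q) * t) ^ (β - 1) * qBinomBound (q ^ β) q := by
  have : 0 < 1 - q := sub_pos.2 hq1
  have hΓ := qGamma_pos hq0 hq1 hβ
  have hc : 0 ≤ qGamma q β * ((1 - q) * t) ^ (β - 1) := by positivity
  rw [qPowKernel_lattice hq0 hq1 hβ ht, abs_mul, abs_of_nonneg hc]
  gcongr
  exact abs_qBinomCoeff_le hq0 hq1 _ n

theorem qPochInf_le_qBinomCoeff (hq0 : 0 < q) (hq1 : q < 1) {a : ℝ} (ha0 : 0 ≤ a) (ha1 : a < 1)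
    (n : ℕ) : qPochInf a q ≤ qBinomCoeff a q n :=
  (qPochInf_le_qPochFin hq0 hq1 ha0 ha1 n).trans
    (le_div_self (qPochFin_pos hq0 hq1 ha1 n).le (qPochFin_pos hq0 hq1 hq1 n)
      (qPochFin_le_one hq0 hq1 hq0.le hq1 n))

theorem jacksonIntegrable_of_qPowKernel_smul (hq0 : 0 < q) (hq1 : q < 1) {β t : ℝ} (hβ : 0 < β)
    (ht : 0 < t) {g : ℝ → E}
    (h : JacksonIntegrable q t fun s => qPowKernel q (β - 1) t s • g s) :
    JacksonIntegrable q t g := by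
  have : 0 < 1 - q := sub_pos.2 hq1
  have hΓ := qGamma_pos hq0 hq1 hβ
  have hβ1 := Real.rpow_lt_one hq0.le hq1 hβ
  have hκ := qPochInf_pos hq0 hq1 hβ1
  set c := qGamma q β * ((1 - q) * t) ^ (β - 1) * qPochInf (q ^ β) q with hc_def
  have hc : 0 < c := by positivity
  refine (jacksonIntegrable_iff hq0).2 (.of_nonneg_of_le (fun n => by positivity) (fun n => ?_)
    (((jacksonIntegrable_iff hq0).1 h).mul_left c⁻¹))
  rw [qPowKernel_lattice hq0 hq1 hβ ht, norm_smul, le_inv_mul_iff₀ hc, mul_left_comm]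
  gcongr
  refine le_trans ?_ (Real.le_norm_self _)
  rw [hc_def]
  gcongr
  exact qPochInf_le_qBinomCoeff hq0 hq1 (by positivity) hβ1 n

end Kernel

section Caputo

variable {q α : ℝ}

theorem ceil_eq_two (hα1 : 1 < α) (hα2 : α < 2) : ⌈α⌉₊ = 2 :=
  (Nat.ceil_eq_iff two_ne_zero).2 ⟨by simpa using hα1, by simpa using hα2.le⟩

theorem qDeriv_iterate_apply {I 𝕜 : Type*} [RCLike 𝕜] (n : ℕ) (u : ℝ → I → 𝕜) (t : ℝ) (k : I) :
    (qDeriv q)^[n] u t k = (qDeriv q)^[n] (fun s => u s k) t := by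
  induction n generalizing u with
  | zero => rfl
  | succ n ih =>
    rw [Function.iterate_succ_apply, Function.iterate_succ_apply, ih]
    rfl

theorem caputo_zero_right {E : Type*} [AddCommGroup E] [Module ℝ E] [TopologicalSpace E]
    (u : ℝ → E) : caputo q α u 0 = 0 := by
  rw [caputo, rlIntegral, jacksonIntegral, mul_zero, zero_smul, smul_zero]

end Caputo

namespace PositiveOperator

variable {𝕜 H I : Type*} [RCLike 𝕜] [NormedAddCommGroup H] [InnerProductSpace 𝕜 H]
  [CompleteSpace H] {L : PositiveOperator 𝕜 H I} {q α d T : ℝ}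

section HasCaputo

variable {u : ℝ → I → 𝕜}

theorem HasCaputo.jacksonIntegrable_kernel (hα1 : 1 < α) (hα2 : α < 2)
    (hu : L.HasCaputo q α d T u) {t : ℝ} (ht : t ∈ Set.Ioc 0 T) (k : I) :
    JacksonIntegrable q t fun s =>
      qPowKernel q (2 - α - 1) t s • (qDeriv q)^[2] (fun s => u s k) s := by
  have h := L.summable_norm_apply (hu t ht) k
  rw [JacksonIntegrable]
  simpa only [ceil_eq_two hα1 hα2, Nat.cast_ofNat, Pi.smul_apply, qDeriv_iterate_apply] using h

theorem HasCaputo.jacksonIntegrable (hq0 : 0 < q) (hq1 : q < 1) (hα1 : 1 < α) (hα2 : α < 2)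
    (hu : L.HasCaputo q α d T u) {t : ℝ} (ht : t ∈ Set.Ioc 0 T) (k : I) :
    JacksonIntegrable q t ((qDeriv q)^[2] fun s => u s k) :=
  jacksonIntegrable_of_qPowKernel_smul hq0 hq1 (sub_pos.2 hα2) ht.1
    (hu.jacksonIntegrable_kernel hα1 hα2 ht k)

theorem HasCaputo.caputo_apply (hq0 : 0 < q) (hq1 : q < 1) (hα1 : 1 < α) (hα2 : α < 2)
    (hu : L.HasCaputo q α d T u) {t : ℝ} (ht : t ∈ Set.Ioc 0 T) (k : I) :
    caputo q α u t k = fracOp q (2 - α) ((qDeriv q)^[2] fun s => u s k) t := by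
  have summable : Summable fun n : ℕ => q ^ n • qPowKernel q (2 - α - 1) t (t * q ^ n) •
      (qDeriv q)^[2] u (t * q ^ n) := Pi.summable.2 fun k => by
    simpa only [Pi.smul_apply, qDeriv_iterate_apply]
      using (hu.jacksonIntegrable_kernel hα1 hα2 ht k).of_norm
  rw [← rlIntegral_eq_fracOp hq0 hq1 (sub_pos.2 hα2) ht.1, caputo, ceil_eq_two hα1 hα2, rlIntegral,
    rlIntegral, jacksonIntegral, jacksonIntegral, Nat.cast_ofNat, Pi.smul_apply, Pi.smul_apply,
    tsum_apply summable]
  simp only [Pi.smul_apply, qDeriv_iterate_apply]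

end HasCaputo

section Volterra

variable {B : ℝ≥0∞} {φ ρ : I → 𝕜} {u G : ℝ → I → 𝕜} {t : ℝ}

theorem eNorm_fracOp_lattice_le (hq0 : 0 < q) (hq1 : q < 1) (a : ℝ)
    (hG : ∀ s ∈ Set.Ioc 0 T, L.eNorm d (G s) ≤ B) (ht : t ∈ Set.Ioc 0 T) (n : ℕ) :
    L.eNorm d (fun k => fracOp q a (fun s => G s k) (t * q ^ n))
      ≤ ENNReal.ofReal (((1 - q) * t) ^ a * (q ^ a) ^ n * qBinomBound (q ^ a) q) *
        (ENNReal.ofReal (1 - q)⁻¹ * B) := by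
  have htn := mem_Ioc_mul_pow hq0 hq1 ht n
  rw [← mul_pow_rpow hq0 (mul_nonneg (sub_pos.2 hq1).le ht.1.le), mul_assoc]
  exact L.eNorm_le_of_enorm_le_tsum hq0 hq1 (g := fun j => G (t * q ^ n * q ^ j))
    (fun j => hG _ (mem_Ioc_mul_pow hq0 hq1 htn j))
    fun k => enorm_fracOp_le hq0 hq1 a htn.1.le fun s => G s k

theorem qDeriv_two_of_volterra (hq0 : 0 < q) (hq1 : q < 1) (hB : B < ∞)
    (hG : ∀ s ∈ Set.Ioc 0 T, L.eNorm d (G s) ≤ B)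
    (hu : ∀ s ∈ Set.Ioc 0 T, ∀ k, u s k = φ k + s • ρ k + fracOp q α (fun s => G s k) s)
    (ht : t ∈ Set.Ioc 0 T) (k : I) :
    (qDeriv q)^[2] (fun s => u s k) t = fracOp q (α - 2) (fun s => G s k) t := by
  obtain ⟨M, hM⟩ := L.exists_norm_apply_le d k hB
  exact qDeriv_two_add_smul_add_fracOp hq0 hq1 (fun s hs => jacksonIntegrable_of_bounded hq0 hq1
    fun n => hM _ (hG _ (mem_Ioc_mul_pow hq0 hq1 hs n))) (fun s hs => hu s hs k) ht

theorem rpow_sub_two_mul_self_lt_one (hq0 : 0 < q) (hq1 : q < 1) (hα1 : 1 < α) :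
    q ^ (α - 2) * q < 1 := by
  rw [← Real.rpow_add_one hq0.ne']
  exact Real.rpow_lt_one hq0.le hq1 (by linarith)

theorem hasCaputo_of_volterra (hq0 : 0 < q) (hq1 : q < 1) (hα1 : 1 < α) (hα2 : α < 2) (hB : B < ∞)
    (hG : ∀ s ∈ Set.Ioc 0 T, L.eNorm d (G s) ≤ B)
    (hu : ∀ s ∈ Set.Ioc 0 T, ∀ k, u s k = φ k + s • ρ k + fracOp q α (fun s => G s k) s) :
    L.HasCaputo q α d T u := by
  intro t ht
  have : 0 < 1 - q := sub_pos.2 hq1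
  have ht0 := ht.1
  have hΓ := qGamma_pos hq0 hq1 (sub_pos.2 hα2)
  rw [ceil_eq_two hα1 hα2, Nat.cast_ofNat]
  set κ := qGamma q (2 - α) * ((1 - q) * t) ^ (2 - α - 1) * qBinomBound (q ^ (2 - α)) q
  set K := ((1 - q) * t) ^ (α - 2) * qBinomBound (q ^ (α - 2)) q
  have hκ : 0 ≤ κ := mul_nonneg (by positivity) (qBinomBound_nonneg hq0 hq1 _)
  have hK : 0 ≤ K := mul_nonneg (by positivity) (qBinomBound_nonneg hq0 hq1 _)
  have term_le : ∀ n : ℕ, L.eNorm d (q ^ n • qPowKernel q (2 - α - 1) t (t * q ^ n) •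
      (qDeriv q)^[2] u (t * q ^ n)) ≤
        ENNReal.ofReal (κ * K * (q ^ (α - 2) * q) ^ n) * (ENNReal.ofReal (1 - q)⁻¹ * B) := by
    intro n
    have hD : (qDeriv q)^[2] u (t * q ^ n)
        = fun k => fracOp q (α - 2) (fun s => G s k) (t * q ^ n) := funext fun k => by
      rw [qDeriv_iterate_apply,
        qDeriv_two_of_volterra hq0 hq1 hB hG hu (mem_Ioc_mul_pow hq0 hq1 ht n)]
    rw [eNorm_smul, eNorm_smul, Real.enorm_of_nonneg (by positivity), Real.enorm_eq_ofReal_abs, hD]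
    calc _ ≤ ENNReal.ofReal (q ^ n) * (ENNReal.ofReal κ * (ENNReal.ofReal (((1 - q) * t) ^ (α - 2) *
          (q ^ (α - 2)) ^ n * qBinomBound (q ^ (α - 2)) q) * (ENNReal.ofReal (1 - q)⁻¹ * B))) := by
          gcongr
          · exact abs_qPowKernel_lattice_le hq0 hq1 (sub_pos.2 hα2) ht0 n
          · exact eNorm_fracOp_lattice_le hq0 hq1 _ hG ht n
      _ = _ := by
          rw [← mul_assoc, ← mul_assoc, ← ENNReal.ofReal_mul (by positivity),
            ← ENNReal.ofReal_mul (by positivity), mul_pow]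
          congr 2
          ring
  refine (ENNReal.tsum_le_tsum term_le).trans_lt ?_
  rw [ENNReal.tsum_mul_right, ← ENNReal.ofReal_tsum_of_nonneg (fun n => by positivity)
    ((summable_geometric_of_lt_one (by positivity)
      (rpow_sub_two_mul_self_lt_one hq0 hq1 hα1)).mul_left _)]
  exact ENNReal.mul_lt_top ENNReal.ofReal_lt_top (ENNReal.mul_lt_top ENNReal.ofReal_lt_top hB)

theorem caputo_of_volterra (hq0 : 0 < q) (hq1 : q < 1) (hα1 : 1 < α) (hα2 : α < 2) (hB : B < ∞)
    (hG : ∀ s ∈ Set.Ioc 0 T, L.eNorm d (G s) ≤ B)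
    (hu : ∀ s ∈ Set.Ioc 0 T, ∀ k, u s k = φ k + s • ρ k + fracOp q α (fun s => G s k) s)
    (ht : t ∈ Set.Ioc 0 T) : caputo q α u t = G t := by
  ext k
  obtain ⟨M, hM⟩ := L.exists_norm_apply_le d k hB
  have hmem := mem_Ioc_mul_pow hq0 hq1 ht
  have hs := summable_antidiagonal_of_bounded (x := q ^ (α - 2)) (g := fun n => G (t * q ^ n) k)
    hq0 hq1 (by positivity) (rpow_sub_two_mul_self_lt_one hq0 hq1 hα1) fun n => hM _ (hG _ (hmem n))
  have hD : fracOp q (2 - α) ((qDeriv q)^[2] fun s => u s k) t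
      = fracOp q (2 - α) (fracOp q (α - 2) fun s => G s k) t :=
    fracOp_congr fun j => qDeriv_two_of_volterra hq0 hq1 hB hG hu (hmem j) k
  have cancel := fracOp_fracOp (g := fun s => G s k) hq0 hq1 (2 - α) (α - 2) ht.1 hs
  rw [sub_add_sub_cancel, sub_self, fracOp_zero] at cancel
  rw [(hasCaputo_of_volterra hq0 hq1 hα1 hα2 hB hG hu).caputo_apply hq0 hq1 hα1 hα2 ht, hD, cancel]

theorem hasQDerivAtZero_of_volterra (hq0 : 0 < q) (hq1 : q < 1) (hα1 : 1 < α) (hB : B < ∞)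
    (hG : ∀ s ∈ Set.Ioc 0 T, L.eNorm d (G s) ≤ B)
    (hu : ∀ s ∈ Set.Ioc 0 T, ∀ k, u s k = φ k + s • ρ k + fracOp q α (fun s => G s k) s)
    (hu0 : u 0 = φ) : L.HasQDerivAtZero q d T u ρ := by
  intro t ht
  have ht0 := ht.1
  set X := ENNReal.ofReal (1 - q)⁻¹ * B
  have hX : X ≠ ∞ := ENNReal.mul_ne_top ENNReal.ofReal_ne_top hB.ne
  set K := t⁻¹ * (((1 - q) * t) ^ α * qBinomBound (q ^ α) q)
  have quotient_le : ∀ n : ℕ, L.eNorm d ((t * q ^ n)⁻¹ • (u (t * q ^ n) - u 0) - ρ)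
      ≤ ENNReal.ofReal (K * (q ^ (α - 1)) ^ n) * X := by
    intro n
    have htn := mem_Ioc_mul_pow hq0 hq1 ht n
    have remainder : (t * q ^ n)⁻¹ • (u (t * q ^ n) - u 0) - ρ
        = (t * q ^ n)⁻¹ • fun k => fracOp q α (fun s => G s k) (t * q ^ n) := by
      ext k
      rw [hu0, Pi.sub_apply, Pi.smul_apply, Pi.smul_apply, Pi.sub_apply, hu _ htn, add_assoc,
        add_sub_cancel_left, smul_add, inv_smul_smul₀ htn.1.ne', add_sub_cancel_left]
    rw [remainder, eNorm_smul, Real.enorm_of_nonneg (inv_nonneg.2 htn.1.le)]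
    refine (mul_le_mul_right (eNorm_fracOp_lattice_le hq0 hq1 α hG ht n) _).trans_eq ?_
    rw [← mul_assoc, ← ENNReal.ofReal_mul (by positivity), Real.rpow_sub_one hq0.ne']
    congr 2
    simp only [K, div_pow]
    field_simp
  have limit : Tendsto (fun n : ℕ => ENNReal.ofReal (K * (q ^ (α - 1)) ^ n) * X) atTop (𝓝 0) := by
    have h := (tendsto_pow_atTop_nhds_zero_of_lt_one (by positivity)
      (Real.rpow_lt_one hq0.le hq1 (sub_pos.2 hα1))).const_mul K
    simpa using ENNReal.Tendsto.mul_const (ENNReal.tendsto_ofReal h) (Or.inr hX)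
  exact tendsto_of_tendsto_of_tendsto_of_le_of_le tendsto_const_nhds limit (fun _ => zero_le)
    quotient_le

end Volterra

end PositiveOperator

/-! ### The series solution -/

section MittagLeffler

variable {q α : ℝ}

theorem summable_resolventSeries (hq0 : 0 < q) (hq1 : q < 1) {r w x : ℝ} (hr : 0 ≤ r)
    (hw : w ≤ 0) (hx : |x| < 1) (a : ℝ) :
    Summable fun j : ℕ => x ^ j * resolventCoeff q r a w j :=
  summable_mul_geometric_of_bounded hx (abs_resolventCoeff_le hq0 hq1 hr hw a)

theorem resolventSeries_one_eq (hq0 : 0 < q) (hq1 : q < 1) {r w x : ℝ} (hr0 : 0 ≤ r)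
    (hr1 : r ≤ 1) (hw : w ≤ 0) (hx : |x| < 1) :
    resolventSeries q r 1 x w = 1 + w * resolventSeries q r r x w := by
  have term : ∀ j : ℕ, x ^ j * resolventCoeff q r 1 w j
      = (if j = 0 then 1 else 0) + w * (x ^ j * resolventCoeff q r r w j) := fun j => by
    have h := mul_resolventCoeff r w 1 q
      (fun n => (one_sub_mul_pow_pos hr0 hr1 (hw.trans_lt one_pos) n).ne') j
    rw [one_mul, qBinomCoeff, qPochFin_one_left, eq_sub_iff_add_eq] at h
    rw [← h, mul_add, mul_left_comm, add_comm]
    congr 1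
    split_ifs with hj <;> simp [hj, qPochFin_zero]
  simp only [resolventSeries, term]
  exact ((hasSum_ite_eq 0 1).add
    ((summable_resolventSeries hq0 hq1 hr0 hw hx r).hasSum.mul_left w)).tsum_eq

theorem qMittagLeffler_one_zero (hq0 : 0 < q) (hq1 : q < 1) (hα : 0 ≤ α) :
    qMittagLeffler q α 1 0 = 1 := by
  rw [qMittagLeffler_eq hq0 hq1 hα one_pos (Real.rpow_pos_of_pos (sub_pos.2 hq1) _),
    qGamma_one hq0 hq1, Real.rpow_one, zero_mul, resolventSeries_one_eq hq0 hq1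
      (Real.rpow_nonneg hq0.le α) (Real.rpow_le_one hq0.le hq1.le hα) le_rfl
      (by rwa [abs_of_pos hq0])]
  simp

end MittagLeffler

section ScalarSolution

variable {E : Type*} [NormedAddCommGroup E] [NormedSpace ℝ E] {q α μ t : ℝ}

theorem resolventOp_rpow_smul (hq0 : 0 < q) (hq1 : q < 1) {β : ℝ} (hβ : 0 < β) (hμ : 0 ≤ μ)
    (ht : 0 ≤ t) (x : E) :
    resolventOp q α μ (fun s => s ^ (β - 1) • x) t
      = (((1 - q) * t) ^ α * t ^ (β - 1) *
        resolventSeries q (q ^ α) (q ^ α) (q ^ β) (-μ * ((1 - q) * t) ^ α)) • x := by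
  have hw : -μ * ((1 - q) * t) ^ α ≤ 0 := mul_nonpos_of_nonpos_of_nonneg (neg_nonpos.2 hμ)
    (Real.rpow_nonneg (mul_nonneg (sub_pos.2 hq1).le ht) α)
  have hx : |q ^ β| < 1 := by
    rw [abs_of_pos (by positivity)]
    exact Real.rpow_lt_one hq0.le hq1 hβ
  have series := (summable_resolventSeries (r := q ^ α) hq0 hq1 (by positivity) hw hx (q ^ α)
    ).tsum_smul_const x
  rw [resolventOp, jacksonSum, resolventSeries, mul_assoc, mul_smul, mul_smul, ← series]
  congr 1
  rw [← tsum_const_smul'']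
  refine tsum_congr fun j => ?_
  rw [mul_pow_rpow hq0 ht, smul_smul, smul_smul, Real.rpow_sub_one hq0.ne', div_pow]
  congr 1
  field_simp

theorem rpow_smul_sub_smul_resolventOp (hq0 : 0 < q) (hq1 : q < 1) (hα : 0 ≤ α) {β : ℝ}
    (hβ : 0 < β) (hμ : 0 ≤ μ) (ht : 0 ≤ t) (x : E) :
    t ^ (β - 1) • x - μ • resolventOp q α μ (fun s => s ^ (β - 1) • x) t
      = (qGamma q β * (t ^ (β - 1) * qMittagLeffler q α β (-μ * t ^ α))) • x := by
  have h1q := sub_pos.2 hq1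
  have hΓ := (qGamma_pos hq0 hq1 hβ).ne'
  have hx : |q ^ β| < 1 := by
    rw [abs_of_pos (by positivity)]
    exact Real.rpow_lt_one hq0.le hq1 hβ
  have hz : -μ * t ^ α ≤ 0 := mul_nonpos_of_nonpos_of_nonneg (neg_nonpos.2 hμ) (by positivity)
  rw [resolventOp_rpow_smul hq0 hq1 hβ hμ ht,
    qMittagLeffler_eq hq0 hq1 hα hβ (hz.trans_lt (by positivity)),
    resolventSeries_one_eq hq0 hq1 (by positivity) (Real.rpow_le_one hq0.le hq1.le hα)
      (mul_nonpos_of_nonpos_of_nonneg hz (by positivity)) hx,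
    Real.mul_rpow h1q.le ht, mul_comm ((1 - q) ^ α), ← mul_assoc (-μ), mul_left_comm (qGamma q β),
    mul_inv_cancel_left₀ hΓ]
  module

theorem resolventOp_sub_smul (hq0 : 0 < q) (hq1 : q < 1) (hμ : 0 ≤ μ) (ht : 0 ≤ t) (c : ℝ)
    {g h : ℝ → E} [CompleteSpace E] (hg : JacksonIntegrable q t g) (hh : JacksonIntegrable q t h) :
    resolventOp q α μ (fun s => g s - c • h s) t
      = resolventOp q α μ g t - c • resolventOp q α μ h t := by
  have hw : -μ * ((1 - q) * t) ^ α ≤ 0 := mul_nonpos_of_nonpos_of_nonneg (neg_nonpos.2 hμ)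
    (Real.rpow_nonneg (mul_nonneg (sub_pos.2 hq1).le ht) α)
  rw [resolventOp, resolventOp, resolventOp, jacksonSum_sub_smul hg hh
    (abs_resolventCoeff_le hq0 hq1 (Real.rpow_nonneg hq0.le α) hw _), smul_sub, smul_comm c]

theorem mittagLeffler_add_resolventOp [CompleteSpace E] (hq0 : 0 < q) (hq1 : q < 1) (hα : 0 ≤ α)
    (hμ : 0 ≤ μ) (ht : 0 ≤ t) {F : ℝ → E} (hF : JacksonIntegrable q t F) (x y : E) :
    qMittagLeffler q α 1 (-μ * t ^ α) • x + (t * qMittagLeffler q α 2 (-μ * t ^ α)) • y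
        + resolventOp q α μ F t
      = x + t • y + resolventOp q α μ (fun s => F s - μ • x - μ • s • y) t := by
  have hx : JacksonIntegrable q t fun _ => x :=
    jacksonIntegrable_of_bounded hq0 hq1 fun _ => le_rfl
  have hy : JacksonIntegrable q t fun s => s • y := by
    refine jacksonIntegrable_of_bounded hq0 hq1 (M := t * ‖y‖) fun n => ?_
    rw [norm_smul, Real.norm_of_nonneg (by positivity)]
    gcongr
    exact mul_le_of_le_one_right ht (pow_le_one₀ hq0.le hq1.le)
  have value := rpow_smul_sub_smul_resolventOp hq0 hq1 hα one_pos hμ ht x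
  have slope := rpow_smul_sub_smul_resolventOp hq0 hq1 hα two_pos hμ ht y
  norm_num [qGamma_one hq0 hq1] at value
  norm_num [qGamma_two hq0 hq1] at slope
  rw [resolventOp_sub_smul hq0 hq1 hμ ht μ (hF.sub_smul hx μ) hy,
    resolventOp_sub_smul hq0 hq1 hμ ht μ hF hx, neg_mul, ← value, ← slope]
  module

theorem duhamelKernel_lattice (hq0 : 0 < q) (hq1 : q < 1) (hα : 0 < α) (hμ : 0 ≤ μ) (ht : 0 < t)
    (n : ℕ) :
    qPowKernel q (α - 1) t (t * q ^ n) *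
        qMittagLefflerTranslate q α α (q ^ α * (t * q ^ n)) (-μ) t
      = ((1 - q) * t) ^ (α - 1) *
        resolventCoeff q (q ^ α) (q ^ α) (-μ * ((1 - q) * t) ^ α) n := by
  have h1q := sub_pos.2 hq1
  have hz : -μ * t ^ α < (1 - q) ^ (-α) :=
    (mul_nonpos_of_nonpos_of_nonneg (neg_nonpos.2 hμ) (by positivity)).trans_lt (by positivity)
  rw [qPowKernel_mul_qMittagLefflerTranslate hq0 hq1 hα.le hα ht hz, mul_assoc (-μ),
    mul_comm (t ^ α), ← Real.mul_rpow h1q.le ht.le]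

theorem jacksonIntegrable_duhamelKernel_smul (hq0 : 0 < q) (hq1 : q < 1) (hα : 0 < α) (hμ : 0 ≤ μ)
    (ht : 0 < t) {F : ℝ → E} (hF : JacksonIntegrable q t F) :
    JacksonIntegrable q t fun s => (qPowKernel q (α - 1) t s *
      qMittagLefflerTranslate q α α (q ^ α * s) (-μ) t) • F s := by
  have : 0 < (1 - q) * t := mul_pos (sub_pos.2 hq1) ht
  have hw : -μ * ((1 - q) * t) ^ α ≤ 0 :=
    mul_nonpos_of_nonpos_of_nonneg (neg_nonpos.2 hμ) (by positivity)
  refine hF.bdd_smul (K := ((1 - q) * t) ^ (α - 1) * qBinomBound (q ^ α) q) fun n => ?_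
  rw [duhamelKernel_lattice hq0 hq1 hα hμ ht, abs_mul, abs_of_pos (by positivity)]
  gcongr
  exact abs_resolventCoeff_le hq0 hq1 (by positivity) hw _ n

theorem jacksonIntegral_duhamelKernel_smul (hq0 : 0 < q) (hq1 : q < 1) (hα : 0 < α) (hμ : 0 ≤ μ)
    (ht : 0 < t) (F : ℝ → E) :
    jacksonIntegral q t (fun s => (qPowKernel q (α - 1) t s *
      qMittagLefflerTranslate q α α (q ^ α * s) (-μ) t) • F s) = resolventOp q α μ F t := by
  have hs0 : (1 - q) * t ≠ 0 := (mul_pos (sub_pos.2 hq1) ht).ne'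
  have term : ∀ n : ℕ, q ^ n • (qPowKernel q (α - 1) t (t * q ^ n) *
        qMittagLefflerTranslate q α α (q ^ α * (t * q ^ n)) (-μ) t) • F (t * q ^ n)
      = ((1 - q) * t) ^ (α - 1) • (q ^ n *
        resolventCoeff q (q ^ α) (q ^ α) (-μ * ((1 - q) * t) ^ α) n) • F (t * q ^ n) := fun n => by
    rw [duhamelKernel_lattice hq0 hq1 hα hμ ht, smul_smul, smul_smul, mul_left_comm]
  simp only [jacksonIntegral, term]
  rw [tsum_const_smul'', smul_smul, Real.rpow_sub_one hs0, mul_div_cancel₀ _ hs0, resolventOp,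
    jacksonSum]

end ScalarSolution

section Constants

theorem add_add_sq_le (a b c : ℝ≥0∞) : (a + b + c) ^ 2 ≤ 3 * (a ^ 2 + b ^ 2 + c ^ 2) := by
  have h := ENNReal.rpow_sum_le_const_mul_sum_rpow Finset.univ ![a, b, c] one_le_two
  norm_num [Fin.sum_univ_three] at h
  exact h

/-- A bound of `𝓛 + m` as an operator from `𝓗^{d+2}` to `𝓗^d`. -/
def shiftBound (m : ℝ) : ℝ≥0 := 1 + m.toNNReal

/-- A bound, in `𝓗^d` and on `(0, T]`, of the source `f - (𝓛 + m) (φ + t ρ)` of the problem with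
vanishing initial data, when `φ`, `ρ` and `f` are bounded by `1`. -/
def sourceBound (m T : ℝ) : ℝ≥0 := 1 + shiftBound m * (1 + T.toNNReal)

/-- A bound, in `𝓗^{d+2}` and on `(0, T]`, of the solution of the problem with vanishing initial
data and a source bounded by `1` in `𝓗^d`. -/
def resolventBound (q α T : ℝ) : ℝ≥0 :=
  ((2 * qBinomBound 1 q).toNNReal + (((1 - q) * T) ^ α * qBinomBound (q ^ α) q).toNNReal) *
    (1 - q)⁻¹.toNNReal

/-- A bound of the series solution in `𝓗^{d+2}` when `φ`, `ρ` and `f` are bounded by `1`. -/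
def solutionBound (q α m T : ℝ) : ℝ≥0 :=
  1 + T.toNNReal + resolventBound q α T * sourceBound m T

/-- A bound of the Caputo derivative of the series solution in `𝓗^d` when `φ`, `ρ` and `f` are
bounded by `1`. -/
def caputoBound (q α m T : ℝ) : ℝ≥0 := 1 + shiftBound m * solutionBound q α m T

end Constants

namespace PositiveOperator

variable {𝕜 H I : Type*} [RCLike 𝕜] [NormedAddCommGroup H] [InnerProductSpace 𝕜 H]
  [CompleteSpace H] (L : PositiveOperator 𝕜 H I) {q α m d t T : ℝ}

/-- The operator `𝓛 + m` on `𝓛`-distributions. -/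
def shift (m : ℝ) (c : I → 𝕜) (k : I) : 𝕜 := (L.eigenvalue k + m) • c k

theorem act_add_smul (c : I → 𝕜) : L.act c + m • c = L.shift m c := by
  ext k
  simp only [Pi.add_apply, Pi.smul_apply, act, shift, add_smul]

theorem eigenvalue_add_nonneg (hm : 0 ≤ m) (k : I) : 0 ≤ L.eigenvalue k + m :=
  add_nonneg (L.eigenvalue_nonneg k) hm

theorem eNorm_zero (d : ℝ) : L.eNorm d (0 : I → 𝕜) = 0 := by
  simpa using L.eNorm_smul d 0 0

theorem eNorm_le_eNorm_add_two (d : ℝ) (c : I → 𝕜) : L.eNorm d c ≤ L.eNorm (d + 2) c := by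
  rw [← one_mul (L.eNorm (d + 2) c), ← ENNReal.coe_one]
  refine L.eNorm_le_mul_of_norm_le fun k => ?_
  rw [sub_add_cancel_left, neg_div_self two_ne_zero, Real.rpow_neg_one, NNReal.coe_one]
  gcongr
  exact inv_le_one_of_one_le₀ (le_add_of_nonneg_right (L.eigenvalue_nonneg k))

theorem eNorm_shift_le (hm : 0 ≤ m) (d : ℝ) (c : I → 𝕜) :
    L.eNorm d (L.shift m c) ≤ shiftBound m * L.eNorm (d + 2) c := by
  refine L.eNorm_le_mul_of_norm_le fun k => ?_
  rw [sub_add_cancel_left, neg_div_self two_ne_zero, Real.rpow_neg_one, shift, norm_smul,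
    Real.norm_of_nonneg (L.eigenvalue_add_nonneg hm k), ← mul_assoc]
  gcongr
  rw [inv_mul_le_iff₀ (L.one_add_eigenvalue_pos k), shiftBound, NNReal.coe_add, NNReal.coe_one,
    Real.coe_toNNReal m hm]
  nlinarith [L.eigenvalue_nonneg k]

theorem eNorm_add_two_le (hm : 0 ≤ m) (d : ℝ) (c : I → 𝕜) :
    L.eNorm (d + 2) c ≤ L.eNorm d (L.shift m c) + L.eNorm d c := by
  have norm_eq : L.eNorm (d + 2) c ≤ (1 : ℝ≥0) * L.eNorm d (L.shift 1 c) :=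
    L.eNorm_le_mul_of_norm_le fun k => by
      rw [add_sub_cancel_left, div_self two_ne_zero, Real.rpow_one, shift, norm_smul,
        Real.norm_of_nonneg (L.eigenvalue_add_nonneg zero_le_one k), add_comm, NNReal.coe_one,
        one_mul]
  have act_le : L.eNorm d (L.act c) ≤ (1 : ℝ≥0) * L.eNorm d (L.shift m c) :=
    L.eNorm_le_mul_of_norm_le fun k => by
      rw [sub_self, zero_div, Real.rpow_zero, one_mul, act, shift, norm_smul, norm_smul,
        Real.norm_of_nonneg (L.eigenvalue_nonneg k),
        Real.norm_of_nonneg (L.eigenvalue_add_nonneg hm k), NNReal.coe_one, one_mul]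
      gcongr
      exact le_add_of_nonneg_right hm
  rw [ENNReal.coe_one, one_mul] at norm_eq act_le
  rw [← act_add_smul, one_smul] at norm_eq
  exact norm_eq.trans ((L.eNorm_add_le d _ _).trans (by gcongr))

variable {φ ρ : I → 𝕜} {f : ℝ → I → 𝕜} {S : ℝ≥0∞}

theorem jacksonIntegrable_apply (hq0 : 0 < q) (hq1 : q < 1) (hS : S < ∞)
    (hf : ∀ s ∈ Set.Ioc 0 T, L.eNorm d (f s) ≤ S) (ht : t ∈ Set.Ioc 0 T) (k : I) :
    JacksonIntegrable q t fun s => f s k := by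
  obtain ⟨M, hM⟩ := L.exists_norm_apply_le d k hS
  exact jacksonIntegrable_of_bounded hq0 hq1 fun n => hM _ (hf _ (mem_Ioc_mul_pow hq0 hq1 ht n))

theorem jacksonIntegrable_duhamelIntegrand (hq0 : 0 < q) (hq1 : q < 1) (hα : 0 < α) (hm : 0 ≤ m)
    (hS : S < ∞) (hf : ∀ s ∈ Set.Ioc 0 T, L.eNorm d (f s) ≤ S) (ht : t ∈ Set.Icc 0 T) (k : I) :
    JacksonIntegrable q t (L.duhamelIntegrand q α m f t k) := by
  rcases ht.1.eq_or_lt with rfl | ht0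
  · exact jacksonIntegrable_of_bounded hq0 hq1 fun n => by rw [zero_mul]
  · exact jacksonIntegrable_duhamelKernel_smul hq0 hq1 hα (L.eigenvalue_add_nonneg hm k) ht0
      (L.jacksonIntegrable_apply hq0 hq1 hS hf ⟨ht0, ht.2⟩ k)

/-- The source of the problem with vanishing initial data that is satisfied by `u - φ - t ρ`. -/
def source (m : ℝ) (φ ρ : I → 𝕜) (f : ℝ → I → 𝕜) (s : ℝ) : I → 𝕜 :=
  f s - L.shift m φ - L.shift m (s • ρ)

theorem source_apply (m : ℝ) (φ ρ : I → 𝕜) (f : ℝ → I → 𝕜) (s : ℝ) (k : I) :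
    L.source m φ ρ f s k
      = f s k - (L.eigenvalue k + m) • φ k - (L.eigenvalue k + m) • s • ρ k := rfl

theorem eNorm_smul_le_toNNReal_mul (hρ : L.eNorm d ρ ≤ S) (ht : t ∈ Set.Ioc 0 T) :
    L.eNorm d (t • ρ) ≤ T.toNNReal * S := by
  rw [eNorm_smul, Real.enorm_of_nonneg ht.1.le]
  exact mul_le_mul' (ENNReal.ofReal_le_ofReal ht.2) hρ

theorem eNorm_source_le (hm : 0 ≤ m) (hφ : L.eNorm (d + 2) φ ≤ S) (hρ : L.eNorm (d + 2) ρ ≤ S)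
    (hf : L.eNorm d (f t) ≤ S) (ht : t ∈ Set.Ioc 0 T) :
    L.eNorm d (L.source m φ ρ f t) ≤ sourceBound m T * S :=
  calc L.eNorm d (L.source m φ ρ f t)
      ≤ L.eNorm d (f t) + L.eNorm d (L.shift m φ) + L.eNorm d (L.shift m (t • ρ)) :=
        (L.eNorm_sub_le d _ _).trans (by gcongr; exact L.eNorm_sub_le d _ _)
    _ ≤ S + shiftBound m * S + shiftBound m * (T.toNNReal * S) := by
        gcongr
        · exact (L.eNorm_shift_le hm d φ).trans (by gcongr)
        · exact (L.eNorm_shift_le hm d _).trans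
            (by gcongr; exact L.eNorm_smul_le_toNNReal_mul hρ ht)
    _ = sourceBound m T * S := by rw [sourceBound]; push_cast; ring

theorem seriesSolution_zero (hq0 : 0 < q) (hq1 : q < 1) (hα : 0 < α) (φ ρ : I → 𝕜)
    (f : ℝ → I → 𝕜) : L.seriesSolution q α m φ ρ f 0 = φ := by
  ext k
  rw [seriesSolution, Real.zero_rpow hα.ne', mul_zero, qMittagLeffler_one_zero hq0 hq1 hα.le,
    jacksonIntegral, zero_mul, mul_zero, zero_smul, zero_smul, one_smul, add_zero, add_zero]

theorem seriesSolution_apply (hq0 : 0 < q) (hq1 : q < 1) (hα : 0 < α) (hm : 0 ≤ m) (hS : S < ∞)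
    (hf : ∀ s ∈ Set.Ioc 0 T, L.eNorm d (f s) ≤ S) (ht : t ∈ Set.Ioc 0 T) (k : I) :
    L.seriesSolution q α m φ ρ f t k = φ k + t • ρ k +
      resolventOp q α (L.eigenvalue k + m) (fun s => L.source m φ ρ f s k) t := by
  have hμ := L.eigenvalue_add_nonneg hm k
  have duhamel := jacksonIntegral_duhamelKernel_smul hq0 hq1 hα hμ ht.1 fun s => f s k
  simp only [source_apply]
  rw [← mittagLeffler_add_resolventOp hq0 hq1 hα.le hμ ht.1.le
    (L.jacksonIntegrable_apply hq0 hq1 hS hf ht k), ← duhamel]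
  rfl

theorem eNorm_resolventOp_le (hq0 : 0 < q) (hq1 : q < 1) (hα : 0 ≤ α) (hm : 0 ≤ m)
    (hf : ∀ s ∈ Set.Ioc 0 T, L.eNorm d (f s) ≤ S) (ht : t ∈ Set.Ioc 0 T) :
    L.eNorm (d + 2) (fun k => resolventOp q α (L.eigenvalue k + m) (fun s => f s k) t)
      ≤ resolventBound q α T * S := by
  set v : I → 𝕜 := fun k => resolventOp q α (L.eigenvalue k + m) (fun s => f s k) t
  have hfS := fun j => hf _ (mem_Ioc_mul_pow hq0 hq1 ht j)
  have shift_le : L.eNorm d (L.shift m v)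
      ≤ ENNReal.ofReal (2 * qBinomBound 1 q) * (ENNReal.ofReal (1 - q)⁻¹ * S) :=
    L.eNorm_le_of_enorm_le_tsum hq0 hq1 hfS fun k =>
      enorm_smul_resolventOp_le hq0 hq1 hα (L.eigenvalue_add_nonneg hm k) ht.1.le fun s => f s k
  have le : L.eNorm d v ≤ ENNReal.ofReal (((1 - q) * t) ^ α * qBinomBound (q ^ α) q) *
      (ENNReal.ofReal (1 - q)⁻¹ * S) :=
    L.eNorm_le_of_enorm_le_tsum hq0 hq1 hfS fun k =>
      enorm_resolventOp_le hq0 hq1 (L.eigenvalue_add_nonneg hm k) ht.1.le fun s => f s k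
  have mono : ((1 - q) * t) ^ α * qBinomBound (q ^ α) q
      ≤ ((1 - q) * T) ^ α * qBinomBound (q ^ α) q := by
    have : 0 ≤ 1 - q := (sub_pos.2 hq1).le
    have ht0 := ht.1.le
    have := qBinomBound_nonneg hq0 hq1 (q ^ α)
    gcongr
    exact ht.2
  calc L.eNorm (d + 2) v ≤ L.eNorm d (L.shift m v) + L.eNorm d v := L.eNorm_add_two_le hm d v
    _ ≤ ENNReal.ofReal (2 * qBinomBound 1 q) * (ENNReal.ofReal (1 - q)⁻¹ * S) +
          ENNReal.ofReal (((1 - q) * T) ^ α * qBinomBound (q ^ α) q) *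
            (ENNReal.ofReal (1 - q)⁻¹ * S) := add_le_add shift_le (le.trans (by gcongr))
    _ = resolventBound q α T * S := by
        simp only [resolventBound, ENNReal.ofReal]
        push_cast
        ring

theorem eNorm_seriesSolution_le (hq0 : 0 < q) (hq1 : q < 1) (hα : 0 < α) (hm : 0 ≤ m) (hS : S < ∞)
    (hφ : L.eNorm (d + 2) φ ≤ S) (hρ : L.eNorm (d + 2) ρ ≤ S)
    (hf : ∀ s ∈ Set.Ioc 0 T, L.eNorm d (f s) ≤ S) (ht : t ∈ Set.Icc 0 T) :
    L.eNorm (d + 2) (L.seriesSolution q α m φ ρ f t) ≤ solutionBound q α m T * S := by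
  have expand : (solutionBound q α m T : ℝ≥0∞) * S
      = S + T.toNNReal * S + resolventBound q α T * (sourceBound m T * S) := by
    rw [solutionBound]
    push_cast
    ring
  rw [expand]
  rcases ht.1.eq_or_lt with rfl | ht0
  · rw [L.seriesSolution_zero hq0 hq1 hα]
    exact hφ.trans (le_self_add.trans le_self_add)
  · have ht' : t ∈ Set.Ioc 0 T := ⟨ht0, ht.2⟩
    have sum_eq : L.seriesSolution q α m φ ρ f t = φ + t • ρ + fun k =>
        resolventOp q α (L.eigenvalue k + m) (fun s => L.source m φ ρ f s k) t :=
      funext fun k => L.seriesSolution_apply hq0 hq1 hα hm hS hf ht' k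
    rw [sum_eq]
    refine (L.eNorm_add_le _ _ _).trans (add_le_add ((L.eNorm_add_le _ _ _).trans
      (add_le_add hφ (L.eNorm_smul_le_toNNReal_mul hρ ht'))) ?_)
    exact L.eNorm_resolventOp_le hq0 hq1 hα.le hm
      (fun s hs => L.eNorm_source_le hm hφ hρ (hf s hs) hs) ht'

theorem seriesSolution_volterra (hq0 : 0 < q) (hq1 : q < 1) (hα : 0 < α) (hm : 0 ≤ m) (hS : S < ∞)
    (hφ : L.eNorm (d + 2) φ ≤ S) (hρ : L.eNorm (d + 2) ρ ≤ S)
    (hf : ∀ s ∈ Set.Ioc 0 T, L.eNorm d (f s) ≤ S) (ht : t ∈ Set.Ioc 0 T) (k : I) :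
    L.seriesSolution q α m φ ρ f t k = φ k + t • ρ k +
      fracOp q α (fun s => (f s - L.shift m (L.seriesSolution q α m φ ρ f s)) k) t := by
  have hmem := mem_Ioc_mul_pow hq0 hq1 ht
  obtain ⟨M, hM⟩ := L.exists_norm_apply_le d k
    (ENNReal.mul_lt_top (ENNReal.coe_lt_top (r := sourceBound m T)) hS)
  rw [L.seriesSolution_apply hq0 hq1 hα hm hS hf ht, resolventOp_volterra hq0 hq1 hα
    (L.eigenvalue_add_nonneg hm k) ht.1.le
    fun n => hM _ (L.eNorm_source_le hm hφ hρ (hf _ (hmem n)) (hmem n))]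
  congr 1
  refine fracOp_congr fun j => ?_
  rw [Pi.sub_apply, shift, L.seriesSolution_apply hq0 hq1 hα hm hS hf (hmem j), source_apply]
  module

theorem eNorm_sub_shift_seriesSolution_le (hq0 : 0 < q) (hq1 : q < 1) (hα : 0 < α) (hm : 0 ≤ m)
    (hS : S < ∞) (hφ : L.eNorm (d + 2) φ ≤ S) (hρ : L.eNorm (d + 2) ρ ≤ S)
    (hf : ∀ s ∈ Set.Ioc 0 T, L.eNorm d (f s) ≤ S) (ht : t ∈ Set.Ioc 0 T) :
    L.eNorm d (f t - L.shift m (L.seriesSolution q α m φ ρ f t)) ≤ caputoBound q α m T * S :=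
  calc _ ≤ L.eNorm d (f t) + L.eNorm d (L.shift m (L.seriesSolution q α m φ ρ f t)) :=
        L.eNorm_sub_le d _ _
    _ ≤ S + shiftBound m * (solutionBound q α m T * S) := by
        gcongr
        · exact hf t ht
        · refine (L.eNorm_shift_le hm d _).trans ?_
          gcongr
          exact L.eNorm_seriesSolution_le hq0 hq1 hα hm hS hφ hρ hf (Set.Ioc_subset_Icc_self ht)
    _ = caputoBound q α m T * S := by rw [caputoBound]; push_cast; ring

theorem caputo_seriesSolution (hq0 : 0 < q) (hq1 : q < 1) (hα1 : 1 < α) (hα2 : α < 2)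
    (hm : 0 ≤ m) (hS : S < ∞) (hφ : L.eNorm (d + 2) φ ≤ S) (hρ : L.eNorm (d + 2) ρ ≤ S)
    (hf : ∀ s ∈ Set.Ioc 0 T, L.eNorm d (f s) ≤ S) (ht : t ∈ Set.Ioc 0 T) :
    caputo q α (L.seriesSolution q α m φ ρ f) t
      = f t - L.shift m (L.seriesSolution q α m φ ρ f t) :=
  have hα := one_pos.trans hα1
  L.caputo_of_volterra (G := fun s => f s - L.shift m (L.seriesSolution q α m φ ρ f s))
    hq0 hq1 hα1 hα2 (ENNReal.mul_lt_top ENNReal.coe_lt_top hS)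
    (fun _ => L.eNorm_sub_shift_seriesSolution_le hq0 hq1 hα hm hS hφ hρ hf)
    (fun _ => L.seriesSolution_volterra hq0 hq1 hα hm hS hφ hρ hf) ht

theorem eNorm_caputo_seriesSolution_le (hq0 : 0 < q) (hq1 : q < 1) (hα1 : 1 < α) (hα2 : α < 2)
    (hm : 0 ≤ m) (hS : S < ∞) (hφ : L.eNorm (d + 2) φ ≤ S) (hρ : L.eNorm (d + 2) ρ ≤ S)
    (hf : ∀ s ∈ Set.Ioc 0 T, L.eNorm d (f s) ≤ S) (ht : t ∈ Set.Icc 0 T) :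
    L.eNorm d (caputo q α (L.seriesSolution q α m φ ρ f) t) ≤ caputoBound q α m T * S := by
  rcases ht.1.eq_or_lt with rfl | ht0
  · rw [caputo_zero_right, eNorm_zero]
    exact zero_le
  · rw [L.caputo_seriesSolution hq0 hq1 hα1 hα2 hm hS hφ hρ hf ⟨ht0, ht.2⟩]
    exact L.eNorm_sub_shift_seriesSolution_le hq0 hq1 (one_pos.trans hα1) hm hS hφ hρ hf
      ⟨ht0, ht.2⟩

theorem isGeneralisedSolution_seriesSolution (hq0 : 0 < q) (hq1 : q < 1) (hα1 : 1 < α)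
    (hα2 : α < 2) (hm : 0 ≤ m) (hS : S < ∞) (hφ : L.eNorm (d + 2) φ ≤ S)
    (hρ : L.eNorm (d + 2) ρ ≤ S) (hf : ∀ s ∈ Set.Ioc 0 T, L.eNorm d (f s) ≤ S) :
    L.IsGeneralisedSolution q α m d T φ ρ f (L.seriesSolution q α m φ ρ f) := by
  have hα := one_pos.trans hα1
  have finite (K : ℝ≥0) : K * S < ∞ := ENNReal.mul_lt_top ENNReal.coe_lt_top hS
  have bound := fun t ht => L.eNorm_seriesSolution_le (t := t) hq0 hq1 hα hm hS hφ hρ hf ht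
  have caputo_bound := fun t ht =>
    L.eNorm_caputo_seriesSolution_le (t := t) hq0 hq1 hα1 hα2 hm hS hφ hρ hf ht
  have volterra := fun s hs => L.seriesSolution_volterra (t := s) hq0 hq1 hα hm hS hφ hρ hf hs
  have hG := fun s hs =>
    L.eNorm_sub_shift_seriesSolution_le (t := s) hq0 hq1 hα hm hS hφ hρ hf hs
  have initial := L.seriesSolution_zero (m := m) hq0 hq1 hα φ ρ f
  exact {
    memLinfty := (iSup₂_le bound).trans_lt (finite _)
    memW := ⟨L.hasCaputo_of_volterra hq0 hq1 hα1 hα2 (finite _) hG volterra, ENNReal.add_lt_top.2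
      ⟨(iSup₂_le fun t ht => (L.eNorm_le_eNorm_add_two d _).trans (bound t ht)).trans_lt
          (finite _), (iSup₂_le caputo_bound).trans_lt (finite _)⟩⟩
    equation := fun t ht => by
      rw [L.caputo_seriesSolution hq0 hq1 hα1 hα2 hm hS hφ hρ hf ht, add_assoc, act_add_smul,
        sub_add_cancel]
    initial := initial
    initial_deriv := L.hasQDerivAtZero_of_volterra hq0 hq1 hα1 (finite _) hG volterra initial }

variable {L} {u v : ℝ → I → 𝕜}

theorem IsGeneralisedSolution.volterra (hq0 : 0 < q) (hq1 : q < 1) (hα1 : 1 < α) (hα2 : α < 2)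
    (hv : L.IsGeneralisedSolution q α m d T φ ρ f v) (ht : t ∈ Set.Ioc 0 T) (k : I) :
    v t k = φ k + t • ρ k + fracOp q α (fun s => f s k - (L.eigenvalue k + m) • v s k) t := by
  have hmem := mem_Ioc_mul_pow hq0 hq1 ht
  rw [← hv.initial]
  refine eq_add_fracOp_of_caputo (v := fun s => v s k) hq0 hq1 hα2 ht.1
    (hv.memW.1.jacksonIntegrable hq0 hq1 hα1 hα2 ht k)
    (L.tendsto_apply_of_eNorm (hv.initial_deriv t ht) k) fun n => ?_
  rw [← hv.memW.1.caputo_apply hq0 hq1 hα1 hα2 (hmem n), ← hv.equation _ (hmem n), add_assoc,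
    act_add_smul, Pi.add_apply, shift, add_sub_cancel_right]

theorem IsGeneralisedSolution.jacksonIntegrable (hq0 : 0 < q) (hq1 : q < 1)
    (hv : L.IsGeneralisedSolution q α m d T φ ρ f v) (ht : t ∈ Set.Ioc 0 T) (k : I) :
    JacksonIntegrable q t fun s => v s k :=
  L.jacksonIntegrable_apply (d := d + 2) (f := v) (S := ⨆ s ∈ Set.Icc 0 T, L.eNorm (d + 2) (v s))
    hq0 hq1 hv.memLinfty (fun s hs =>
      le_iSup₂ (f := fun s (_ : s ∈ Set.Icc 0 T) => L.eNorm (d + 2) (v s)) s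
        (Set.Ioc_subset_Icc_self hs)) ht k

theorem IsGeneralisedSolution.unique (hq0 : 0 < q) (hq1 : q < 1) (hα1 : 1 < α) (hα2 : α < 2)
    (hm : 0 ≤ m) (hS : S < ∞) (hf : ∀ s ∈ Set.Ioc 0 T, L.eNorm d (f s) ≤ S)
    (hu : L.IsGeneralisedSolution q α m d T φ ρ f u)
    (hv : L.IsGeneralisedSolution q α m d T φ ρ f v) (ht : t ∈ Set.Icc 0 T) : u t = v t := by
  rcases ht.1.eq_or_lt with rfl | ht0
  · rw [hu.initial, hv.initial]
  · have ht' : t ∈ Set.Ioc 0 T := ⟨ht0, ht.2⟩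
    have hmem := mem_Ioc_mul_pow hq0 hq1 ht'
    ext k
    exact volterra_unique (x := fun s => φ k + s • ρ k) (u := fun s => u s k)
      (v := fun s => v s k) hq0 hq1 (one_pos.trans hα1) (L.eigenvalue_add_nonneg hm k) ht0.le
      (L.jacksonIntegrable_apply hq0 hq1 hS hf ht' k) (hu.jacksonIntegrable hq0 hq1 ht' k)
      (hv.jacksonIntegrable hq0 hq1 ht' k)
      (fun n => hu.volterra hq0 hq1 hα1 hα2 (hmem n) k)
      (fun n => hv.volterra hq0 hq1 hα1 hα2 (hmem n) k)

variable (L)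

theorem eNorm_le_eNormC_zero (f : ℝ → I → 𝕜) (ht : t ∈ Set.Ioc 0 T) :
    L.eNorm d (f t) ≤ L.eNormC q 0 d T f := by
  rw [eNormC, Finset.sum_range_one]
  exact le_iSup₂ (f := fun s (_ : s ∈ Set.Ioc 0 T) => L.eNorm d (f s)) t ht

theorem eNormC_mono (q d T : ℝ) (f : ℝ → I → 𝕜) : Monotone fun n => L.eNormC q n d T f :=
  fun _ _ h => Finset.sum_le_sum_of_subset (Finset.range_mono (by lia))

theorem eNorm_caputo_sq_add_eNorm_sq_le (hq0 : 0 < q) (hq1 : q < 1) (hα1 : 1 < α) (hα2 : α < 2)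
    (hm : 0 ≤ m) (hφ : L.eNorm (d + 2) φ < ∞) (hρ : L.eNorm (d + 2) ρ < ∞) (hS : S < ∞)
    (hf : ∀ s ∈ Set.Ioc 0 T, L.eNorm d (f s) ≤ S) (ht : t ∈ Set.Icc 0 T) :
    L.eNorm d (caputo q α (L.seriesSolution q α m φ ρ f) t) ^ 2
        + L.eNorm (d + 2) (L.seriesSolution q α m φ ρ f t) ^ 2
      ≤ ((caputoBound q α m T ^ 2 + solutionBound q α m T ^ 2) * 3 : ℝ≥0) *
        (L.eNorm (d + 2) φ ^ 2 + L.eNorm (d + 2) ρ ^ 2 + S ^ 2) := by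
  set R := L.eNorm (d + 2) φ + L.eNorm (d + 2) ρ + S
  have hR : R < ∞ := ENNReal.add_lt_top.2 ⟨ENNReal.add_lt_top.2 ⟨hφ, hρ⟩, hS⟩
  have hφR : L.eNorm (d + 2) φ ≤ R := le_self_add.trans le_self_add
  have hρR : L.eNorm (d + 2) ρ ≤ R := le_add_self.trans le_self_add
  have hfR : ∀ s ∈ Set.Ioc 0 T, L.eNorm d (f s) ≤ R := fun s hs => (hf s hs).trans le_add_self
  calc _ ≤ (caputoBound q α m T * R) ^ 2 + (solutionBound q α m T * R) ^ 2 := by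
        gcongr
        · exact L.eNorm_caputo_seriesSolution_le hq0 hq1 hα1 hα2 hm hR hφR hρR hfR ht
        · exact L.eNorm_seriesSolution_le hq0 hq1 (one_pos.trans hα1) hm hR hφR hρR hfR ht
    _ = (caputoBound q α m T ^ 2 + solutionBound q α m T ^ 2 : ℝ≥0) * R ^ 2 := by
        push_cast
        ring
    _ ≤ (caputoBound q α m T ^ 2 + solutionBound q α m T ^ 2 : ℝ≥0) *
          (3 * (L.eNorm (d + 2) φ ^ 2 + L.eNorm (d + 2) ρ ^ 2 + S ^ 2)) := by
        gcongr
        exact add_add_sq_le _ _ _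
    _ = _ := by
        rw [← mul_assoc]
        push_cast
        rfl

end PositiveOperator

end

theorem theorem4p2_general (q α m T : ℝ) (hq0 : 0 < q) (hq1 : q < 1) (hα1 : 1 < α) (hα2 : α < 2)
    (hm : 0 ≤ m) :
    ∃ C : ℝ≥0, ∀ (𝕜 : Type*) (H : Type*) (I : Type*) [RCLike 𝕜] [NormedAddCommGroup H]
      [InnerProductSpace 𝕜 H] [CompleteSpace H] (L : PositiveOperator 𝕜 H I)
      (d : ℝ) (φ ρ : I → 𝕜) (f : ℝ → I → 𝕜),
      L.eNorm (d + 2) φ < ∞ → L.eNorm (d + 2) ρ < ∞ → L.eNormC q 0 d T f < ∞ →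
      ∃ u : ℝ → I → 𝕜,
        L.IsGeneralisedSolution q α m d T φ ρ f u ∧
        (∀ v : ℝ → I → 𝕜, L.IsGeneralisedSolution q α m d T φ ρ f v →
          ∀ t ∈ Set.Icc 0 T, v t = u t) ∧
        (∀ t ∈ Set.Icc 0 T,
          (∀ k, JacksonIntegrable q t (L.duhamelIntegrand q α m f t k)) ∧
          u t = L.seriesSolution q α m φ ρ f t) ∧
        (∀ t ∈ Set.Icc 0 T,
          L.eNorm d (caputo q α u t) ^ 2 + L.eNorm (d + 2) (u t) ^ 2 ≤
            C * (L.eNorm (d + 2) φ ^ 2 + L.eNorm (d + 2) ρ ^ 2 + L.eNormC q 0 d T f ^ 2)) := by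
  refine ⟨(caputoBound q α m T ^ 2 + solutionBound q α m T ^ 2) * 3,
    fun 𝕜 H I _ _ _ _ L d φ ρ f hφ hρ hF => ?_⟩
  set S := max (L.eNorm (d + 2) φ) (max (L.eNorm (d + 2) ρ) (L.eNormC q 0 d T f))
  have hS : S < ∞ := max_lt hφ (max_lt hρ hF)
  have hf := fun t ht => L.eNorm_le_eNormC_zero (q := q) (d := d) (t := t) (T := T) f ht
  have solution : L.IsGeneralisedSolution q α m d T φ ρ f (L.seriesSolution q α m φ ρ f) :=
    L.isGeneralisedSolution_seriesSolution hq0 hq1 hα1 hα2 hm hS (le_max_left _ _)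
      ((le_max_left _ _).trans (le_max_right _ _))
      fun t ht => (hf t ht).trans ((le_max_right _ _).trans (le_max_right _ _))
  exact ⟨L.seriesSolution q α m φ ρ f, solution,
    fun v hv t ht => hv.unique hq0 hq1 hα1 hα2 hm hF hf solution ht,
    fun t ht => ⟨L.jacksonIntegrable_duhamelIntegrand hq0 hq1 (one_pos.trans hα1) hm hF hf ht, rfl⟩,
    fun t ht => L.eNorm_caputo_sq_add_eNorm_sq_le hq0 hq1 hα1 hα2 hm hφ hρ hF hf ht⟩

theorem theorem4p2 (q α m T : ℝ) (hq0 : 0 < q) (hq1 : q < 1) (hα1 : 1 < α) (hα2 : α < 2)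
    (hm : 0 < m) (hT : 0 < T) :
    ∃ C : ℝ≥0, ∀ (𝕜 : Type*) (H : Type*) (I : Type*) [RCLike 𝕜] [NormedAddCommGroup H]
      [InnerProductSpace 𝕜 H] [CompleteSpace H] [Countable I] (L : PositiveOperator 𝕜 H I)
      (d : ℝ) (φ ρ : I → 𝕜) (f : ℝ → I → 𝕜),
      L.eNorm (d + 2) φ < ∞ → L.eNorm (d + 2) ρ < ∞ → L.MemC q 1 d T f →
      ∃ u : ℝ → I → 𝕜,
        L.IsGeneralisedSolution q α m d T φ ρ f u ∧
        (∀ v : ℝ → I → 𝕜, L.IsGeneralisedSolution q α m d T φ ρ f v →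
          ∀ t ∈ Set.Icc 0 T, v t = u t) ∧
        (∀ t ∈ Set.Icc 0 T,
          (∀ k, JacksonIntegrable q t (L.duhamelIntegrand q α m f t k)) ∧
          u t = L.seriesSolution q α m φ ρ f t) ∧
        (∀ t ∈ Set.Icc 0 T,
          L.eNorm d (caputo q α u t) ^ 2 + L.eNorm (d + 2) (u t) ^ 2 ≤
            C * (L.eNorm (d + 2) φ ^ 2 + L.eNorm (d + 2) ρ ^ 2 + L.eNormC q 1 d T f ^ 2)) := by
  obtain ⟨C, hC⟩ := theorem4p2_general q α m T hq0 hq1 hα1 hα2 hm.le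
  refine ⟨C, fun 𝕜 H I _ _ _ _ _ L d φ ρ f hφ hρ hf => ?_⟩
  have mono : L.eNormC q 0 d T f ≤ L.eNormC q 1 d T f := L.eNormC_mono q d T f zero_le_one
  obtain ⟨u, solution, unique, series, bound⟩ := hC 𝕜 H I L d φ ρ f hφ hρ (mono.trans_lt hf.2)
  exact ⟨u, solution, unique, series, fun t ht => (bound t ht).trans (by gcongr)⟩
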